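/- Conventions. An MV-algebra is a structure $(A,\oplus,{}^*,0)$ where $(A,\oplus,0)$ is an abelian monoid, $x^{**}=x$, $0^*\oplus x=0^*$ and $(x^*\oplus y)^*\oplus y=(y^*\oplus x)^*\oplus x$; put $1=0^*$ and $x\odot y=(x^*\oplus y^*)^*$. The standard MV-algebra is $[0,1]$ with $x\oplus y=\min(x+y,1)$ and $x^*=1-x$. A Riesz MV-algebra is an MV-algebra $R$ with a map $\cdot:[0,1]\times R\to R$ such that $r\cdot(x\odot y^*)=(r\cdot x)\odot(r\cdot y)^*$, $(r\odot q^*)\cdot x=(r\cdot x)\odot(q\cdot x)^*$, $r\cdot(q\cdot x)=(rq)\cdot x$ and $1\cdot x=x$; the standard one is $[0,1]$ with the product of reals. Morphisms are maps preserving all operations. A state on $R$ is a map $s:R\to[0,1]$ with $s(x\oplus y)=s(x)+s(y)$ whenever $x\odot y=0$, $s(1)=1$ and $s(r\cdot x)=r\,s(x)$. Let $n\ge 1$. Formulas of $\mathbb{R}\mathcal{L}$ are built from the propositional variables $v_1,\dots,v_n$ with the connectives $\neg$, $\to$ and $\nabla_r$ ($r\in[0,1]$). Put $\varphi\vee\psi:=(\varphi\to\psi)\to\psi$,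 $\varphi\wedge\psi:=\neg(\neg\varphi\vee\neg\psi)$ and $\varphi\leftrightarrow\psi:=(\varphi\to\psi)\wedge(\psi\to\varphi)$. Provability $\vdash$ is defined by modus ponens and the axiom schemes $\varphi\to(\psi\to\varphi)$; $(\varphi\to\psi)\to((\psi\to\chi)\to(\varphi\to\chi))$; $((\varphi\to\psi)\to\psi)\to((\psi\to\varphi)\to\varphi)$; $(\neg\varphi\to\neg\psi)\to(\psi\to\varphi)$; $\nabla_r(\varphi\to\psi)\leftrightarrow(\nabla_r\varphi\to\nabla_r\psi)$; $\nabla_{r\odot q^*}\varphi\leftrightarrow(\nabla_q\varphi\to\nabla_r\varphi)$; $\nabla_r\nabla_q\varphi\leftrightarrow\nabla_{rq}\varphi$; $\nabla_1\varphi\leftrightarrow\varphi$. $RL_n$ is the Lindenbaum–Tarski algebra: the set of classes $[\varphi]$ of formulas modulo ($\vdash\varphi\to\psi$ and $\vdash\psi\to\varphi$), with $[\varphi]\oplus[\psi]=[\neg\varphi\to\psi]$, $[\varphi]^*=[\neg\varphi]$, $0=[\neg(v_1\to v_1)]$ and $r\cdot[\varphi]=[\neg\nabla_r\neg\varphi]$;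 it is a Riesz MV-algebra. An evaluation is a map $e$ from formulas to $[0,1]$ with $e(\varphi\to\psi)=e(\varphi)^*\oplus e(\psi)$, $e(\neg\varphi)=e(\varphi)^*$ and $e(\nabla_r\varphi)=(r\,e(\varphi)^*)^*$. The term function $\widehat\varphi:[0,1]^n\to[0,1]$ sends $(x_1,\dots,x_n)$ to $e(\varphi)$, where $e$ is the evaluation with $e(v_i)=x_i$ for all $i$. A formula $\varphi$ is invalid if $e(\varphi)=0$ for some evaluation $e$. A formula $\varphi$ is a quasi-linear combination of $f_1,\dots,f_k:[0,1]^n\to\mathbb{R}$ if there are $c_1,\dots,c_k\in\mathbb{R}$ with $\widehat\varphi=\min(\max(\sum_{i=1}^k c_if_i,0),1)$. Theorem. (A) Let $\varphi_1,\dots,\varphi_k$ be formulas of $\mathbb{R}\mathcal{L}$ with variables among $v_1,\dots,v_n$, and let $r_1,\dots,r_k\in[0,1]$. The following are equivalent: (i) the book $\{(\varphi_i,r_i)\mid 1\le i\le k\}$ is coherent: for all $c_1,\dots,c_k\in\mathbb{R}$ there is an evaluation $e$ with $\sum_{i=1}^k c_i(r_i-e(\varphi_i))\ge 0$; (ii)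 there is a state $s:RL_n\to[0,1]$ with $s([\varphi_i])=r_i$ for all $i$; (iii) every quasi-linear combination of $\widehat\varphi_1-r_1,\dots,\widehat\varphi_k-r_k$ is an invalid formula. (B) Let $R$ be a Riesz MV-algebra, $x_1,\dots,x_k\in R$ and $\beta:\{x_1,\dots,x_k\}\to[0,1]$. The following are equivalent: (i) $\beta$ is coherent: for all $c_1,\dots,c_k\in\mathbb{R}$ there is a morphism of MV-algebras $e:R\to[0,1]$ with $\sum_{i=1}^k c_i(\beta(x_i)-e(x_i))\ge 0$; (ii) there is a state $s:R\to[0,1]$ with $s(x_i)=\beta(x_i)$ for all $i$; (iii) there are $m\le k+1$, morphisms of Riesz MV-algebras $e_1,\dots,e_m:R\to[0,1]$ and reals $\alpha_1,\dots,\alpha_m\ge 0$ with $\sum_{j=1}^m\alpha_j=1$ and $\beta(x_i)=\sum_{j=1}^m\alpha_j e_j(x_i)$ for all $i$. -/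

import Mathlib

/-- An MV-algebra `(A, ⊕, *, 0)`. -/
class MVAlgebra (A : Type*) where
  oplus : A → A → A
  neg : A → A
  zero : A
  oplus_assoc : ∀ x y z, oplus (oplus x y) z = oplus x (oplus y z)
  oplus_comm : ∀ x y, oplus x y = oplus y x
  oplus_zero : ∀ x, oplus x zero = x
  neg_neg : ∀ x, neg (neg x) = x
  neg_zero_oplus : ∀ x, oplus (neg zero) x = neg zero
  oplus_neg_oplus : ∀ x y,
    oplus (neg (oplus (neg x) y)) y = oplus (neg (oplus (neg y) x)) x

namespace MVAlgebra

/-- `1 = 0*`. -/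
def one {A : Type*} [MVAlgebra A] : A := neg zero

/-- `x ⊙ y = (x* ⊕ y*)*`. -/
def odot {A : Type*} [MVAlgebra A] (x y : A) : A := neg (oplus (neg x) (neg y))

end MVAlgebra

/-- The standard MV-algebra `[0,1]`, with `x ⊕ y = min (x + y) 1` and `x* = 1 - x`. -/
noncomputable instance unitIntervalMV : MVAlgebra unitInterval where
  oplus x y := ⟨min ((x : ℝ) + (y : ℝ)) 1,
    le_min (add_nonneg x.2.1 y.2.1) zero_le_one, min_le_right _ _⟩
  neg x := ⟨1 - (x : ℝ), sub_nonneg.2 x.2.2, sub_le_self _ x.2.1⟩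
  zero := 0
  oplus_assoc x y z := by
    have hx := x.2.1; have hz := z.2.1
    apply Subtype.ext
    simp only [min_def]
    split_ifs <;> linarith
  oplus_comm x y := by
    apply Subtype.ext
    simp only [add_comm]
  oplus_zero x := by
    apply Subtype.ext
    simp [x.2.2]
  neg_neg x := by
    apply Subtype.ext
    simp
  neg_zero_oplus x := by
    apply Subtype.ext
    simp [x.2.1]
  oplus_neg_oplus x y := by
    have hx := x.2.1; have hy := y.2.1; have hx1 := x.2.2; have hy1 := y.2.2
    apply Subtype.ext
    simp only [min_def]
    split_ifs <;> linarith

theorem coe_odot_neg (x y : unitInterval) :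
    ((MVAlgebra.odot x (MVAlgebra.neg y) : unitInterval) : ℝ) = max ((x : ℝ) - (y : ℝ)) 0 := by
  change 1 - min ((1 - (x : ℝ)) + (1 - (1 - (y : ℝ)))) 1 = _
  rw [min_def, max_def]
  split_ifs <;> linarith

/-- A Riesz MV-algebra: an MV-algebra with a scalar multiplication by elements of `[0,1]`. -/
class RieszMVAlgebra (R : Type*) extends MVAlgebra R where
  scal : unitInterval → R → R
  scal_odot_neg : ∀ r x y,
    scal r (MVAlgebra.odot x (MVAlgebra.neg y))
      = MVAlgebra.odot (scal r x) (MVAlgebra.neg (scal r y))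
  odot_neg_scal : ∀ r q x,
    scal (MVAlgebra.odot r (MVAlgebra.neg q)) x
      = MVAlgebra.odot (scal r x) (MVAlgebra.neg (scal q x))
  scal_scal : ∀ r q x, scal r (scal q x) = scal (r * q) x
  one_scal : ∀ x, scal 1 x = x

/-- The standard Riesz MV-algebra `[0,1]`, whose scalar multiplication is the product of reals. -/
noncomputable instance unitIntervalRieszMV : RieszMVAlgebra unitInterval where
  scal r x := r * x
  scal_odot_neg r x y := by
    apply Subtype.ext
    rw [coe_odot_neg]
    change (r : ℝ) * _ = max ((r : ℝ) * (x : ℝ) - (r : ℝ) * (y : ℝ)) 0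
    rw [coe_odot_neg, mul_max_of_nonneg _ _ r.2.1, mul_sub, mul_zero]
  odot_neg_scal r q x := by
    apply Subtype.ext
    rw [coe_odot_neg]
    change _ * (x : ℝ) = max ((r : ℝ) * (x : ℝ) - (q : ℝ) * (x : ℝ)) 0
    rw [coe_odot_neg, max_mul_of_nonneg _ _ x.2.1, sub_mul, zero_mul]
  scal_scal r q x := (mul_assoc r q x).symm
  one_scal x := one_mul x

/-- Morphisms of MV-algebras. -/
structure IsMVHom {A B : Type*} [MVAlgebra A] [MVAlgebra B] (f : A → B) : Prop where
  map_zero : f MVAlgebra.zero = MVAlgebra.zero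
  map_oplus : ∀ x y, f (MVAlgebra.oplus x y) = MVAlgebra.oplus (f x) (f y)
  map_neg : ∀ x, f (MVAlgebra.neg x) = MVAlgebra.neg (f x)

/-- Morphisms of Riesz MV-algebras. -/
structure IsRieszMVHom {A B : Type*} [RieszMVAlgebra A] [RieszMVAlgebra B] (f : A → B) : Prop
    extends IsMVHom f where
  map_scal : ∀ r x, f (RieszMVAlgebra.scal r x) = RieszMVAlgebra.scal r (f x)

/-- A state on a Riesz MV-algebra: additive, normalized and homogeneous. -/
structure IsState {R : Type*} [RieszMVAlgebra R] (s : R → unitInterval) : Prop where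
  additive : ∀ x y, MVAlgebra.odot x y = MVAlgebra.zero →
    (s (MVAlgebra.oplus x y) : ℝ) = (s x : ℝ) + (s y : ℝ)
  normalized : s MVAlgebra.one = 1
  homogeneous : ∀ (r : unitInterval) x,
    (s (RieszMVAlgebra.scal r x) : ℝ) = (r : ℝ) * (s x : ℝ)

/-- A map `β : {x₁, …, xₖ} → [0,1]` is coherent if for all real `c₁, …, cₖ` some morphism of
MV-algebras `e : A → [0,1]` satisfies `∑ cᵢ (β(xᵢ) - e(xᵢ)) ≥ 0`. -/
def IsCoherentMap {A : Type*} [MVAlgebra A] {k : ℕ} (x : Fin k → A)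
    (β : Set.range x → unitInterval) : Prop :=
  ∀ c : Fin k → ℝ, ∃ e : A → unitInterval, IsMVHom e ∧
    0 ≤ ∑ i, c i * ((β ⟨x i, Set.mem_range_self i⟩ : ℝ) - (e (x i) : ℝ))

/-- The formulas of `ℝℒ` with propositional variables from `V`. -/
inductive Formula (V : Type*) where
  | var : V → Formula V
  | neg : Formula V → Formula V
  | imp : Formula V → Formula V → Formula V
  | nabla : unitInterval → Formula V → Formula V

namespace Formula

/-- `φ ∨ ψ := (φ → ψ) → ψ`. -/
def or {V : Type*} (φ ψ : Formula V) : Formula V := imp (imp φ ψ) ψ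

/-- `φ ∧ ψ := ¬(¬φ ∨ ¬ψ)`. -/
def and {V : Type*} (φ ψ : Formula V) : Formula V := neg (or (neg φ) (neg ψ))

/-- `φ ↔ ψ := (φ → ψ) ∧ (ψ → φ)`. -/
def iff {V : Type*} (φ ψ : Formula V) : Formula V := and (imp φ ψ) (imp ψ φ)

/-- `Δ_r φ := ¬ ∇_r ¬ φ`. -/
def delta {V : Type*} (r : unitInterval) (φ : Formula V) : Formula V := neg (nabla r (neg φ))

/-- Provability in `ℝℒ`: the axiom schemes of the infinite-valued Łukasiewicz logic (`luk1` to
`luk4`), the four schemes for the connectives `∇_r` (`rl1` to `rl4`), and modus ponens. -/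
inductive Provable {V : Type*} : Formula V → Prop where
  | luk1 (φ ψ : Formula V) : Provable (imp φ (imp ψ φ))
  | luk2 (φ ψ χ : Formula V) : Provable (imp (imp φ ψ) (imp (imp ψ χ) (imp φ χ)))
  | luk3 (φ ψ : Formula V) : Provable (imp (imp (imp φ ψ) ψ) (imp (imp ψ φ) φ))
  | luk4 (φ ψ : Formula V) : Provable (imp (imp (neg φ) (neg ψ)) (imp ψ φ))
  | rl1 (r : unitInterval) (φ ψ : Formula V) :
      Provable (iff (nabla r (imp φ ψ)) (imp (nabla r φ) (nabla r ψ)))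
  | rl2 (r q : unitInterval) (φ : Formula V) :
      Provable (iff (nabla (MVAlgebra.odot r (MVAlgebra.neg q)) φ)
        (imp (nabla q φ) (nabla r φ)))
  | rl3 (r q : unitInterval) (φ : Formula V) :
      Provable (iff (nabla r (nabla q φ)) (nabla (r * q) φ))
  | rl4 (φ : Formula V) : Provable (iff (nabla 1 φ) φ)
  | mp {φ ψ : Formula V} : Provable φ → Provable (imp φ ψ) → Provable ψ

/-- `φ ≡ ψ` if `φ → ψ` and `ψ → φ` are provable. -/
def Equiv {V : Type*} (φ ψ : Formula V) : Prop := Provable (imp φ ψ) ∧ Provable (imp ψ φ)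

namespace Provable

variable {V : Type*} {φ ψ χ : Formula V}

theorem trans (h : Provable (imp φ ψ)) (h' : Provable (imp ψ χ)) : Provable (imp φ χ) :=
  mp h' (mp h (luk2 φ ψ χ))

theorem assertion (φ ψ : Formula V) : Provable (imp φ (imp (imp φ ψ) ψ)) :=
  trans (luk1 φ (imp ψ φ)) (luk3 ψ φ)

theorem exchange (φ ψ χ : Formula V) :
    Provable (imp (imp φ (imp ψ χ)) (imp ψ (imp φ χ))) :=
  trans (luk2 φ (imp ψ χ) χ) (mp (assertion ψ χ) (luk2 ψ (imp (imp ψ χ) χ) (imp φ χ)))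

theorem refl (φ : Formula V) : Provable (imp φ φ) :=
  mp (luk1 φ φ) (mp (luk1 φ (imp φ (imp φ φ))) (exchange φ (imp φ (imp φ φ)) φ))

theorem neg_neg (φ : Formula V) : Provable (imp (neg (neg φ)) φ) := by
  have h := trans (luk1 (neg (neg φ)) (neg (neg (imp φ φ))))
    (trans (luk4 (neg (imp φ φ)) (neg φ)) (luk4 φ (imp φ φ)))
  exact mp (refl φ) (mp h (exchange _ _ _))

theorem to_neg_neg (φ : Formula V) : Provable (imp φ (neg (neg φ))) :=
  mp (neg_neg (neg φ)) (luk4 _ _)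

theorem imp_left (h : Provable (imp φ ψ)) (χ : Formula V) :
    Provable (imp (imp ψ χ) (imp φ χ)) := mp h (luk2 φ ψ χ)

theorem imp_right (χ : Formula V) (h : Provable (imp φ ψ)) :
    Provable (imp (imp χ φ) (imp χ ψ)) :=
  mp h (mp (luk2 χ φ ψ) (exchange _ _ _))

theorem contra (φ ψ : Formula V) : Provable (imp (imp φ ψ) (imp (neg ψ) (neg φ))) :=
  trans (imp_right φ (to_neg_neg ψ)) (trans (imp_left (neg_neg φ) _) (luk4 _ _))

theorem neg_mono (h : Provable (imp φ ψ)) : Provable (imp (neg ψ) (neg φ)) :=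
  mp h (contra φ ψ)

theorem and_left (h : Provable (and φ ψ)) : Provable φ :=
  mp (mp h (neg_mono (assertion (neg φ) (neg ψ)))) (neg_neg φ)

theorem and_right (h : Provable (and φ ψ)) : Provable ψ :=
  mp (mp h (neg_mono (luk1 (neg ψ) (imp (neg φ) (neg ψ))))) (neg_neg ψ)

theorem equiv (h : Provable (iff φ ψ)) : Equiv φ ψ := ⟨and_left h, and_right h⟩

theorem nabla_of (r : unitInterval) (φ : Formula V) : Provable (imp φ (nabla r φ)) := by
  have hz : MVAlgebra.odot r (MVAlgebra.neg r) = MVAlgebra.odot r (MVAlgebra.neg 1) := by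
    apply Subtype.ext
    rw [coe_odot_neg, coe_odot_neg, sub_self, max_self]
    exact (max_eq_right (sub_nonpos.2 r.2.2)).symm
  have h0 := mp (refl (nabla r φ)) (and_right (rl2 r r φ))
  rw [hz] at h0
  exact trans (and_right (rl4 φ)) (mp h0 (and_left (rl2 r 1 φ)))

theorem nabla_mono (r : unitInterval) (h : Provable (imp φ ψ)) :
    Provable (imp (nabla r φ) (nabla r ψ)) :=
  mp (mp h (nabla_of r _)) (and_left (rl1 r φ ψ))

end Provable

/-- Provable equivalence as a setoid. -/
def setoid (V : Type*) : Setoid (Formula V) where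
  r := Equiv
  iseqv := ⟨fun φ => ⟨Provable.refl φ, Provable.refl φ⟩, fun h => ⟨h.2, h.1⟩,
    fun h h' => ⟨h.1.trans h'.1, h'.2.trans h.2⟩⟩

end Formula

/-- The Lindenbaum-Tarski algebra of the formulas with variables from `V`. -/
def Lindenbaum (V : Type*) : Type _ := Quotient (Formula.setoid V)

namespace Lindenbaum

open Formula

/-- The class `[φ]`. -/
def mk {V : Type*} (φ : Formula V) : Lindenbaum V := Quotient.mk (Formula.setoid V) φ

theorem mk_eq {V : Type*} {φ ψ : Formula V} (h : Equiv φ ψ) : mk φ = mk ψ :=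
  Quotient.sound (s := Formula.setoid V) h

theorem imp_congr {V : Type*} {φ φ' ψ ψ' : Formula V} (h : Equiv φ φ') (h' : Equiv ψ ψ') :
    Equiv (imp φ ψ) (imp φ' ψ') :=
  ⟨(Provable.imp_left h.2 ψ).trans (Provable.imp_right φ' h'.1),
    (Provable.imp_left h.1 ψ').trans (Provable.imp_right φ h'.2)⟩

theorem neg_congr {V : Type*} {φ ψ : Formula V} (h : Equiv φ ψ) : Equiv (neg φ) (neg ψ) :=
  ⟨h.2.neg_mono, h.1.neg_mono⟩

theorem nabla_congr {V : Type*} (r : unitInterval) {φ ψ : Formula V} (h : Equiv φ ψ) :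
    Equiv (nabla r φ) (nabla r ψ) :=
  ⟨h.1.nabla_mono r, h.2.nabla_mono r⟩

/-- `[φ] ⊕ [ψ] = [¬φ → ψ]`. -/
def oplus {V : Type*} : Lindenbaum V → Lindenbaum V → Lindenbaum V :=
  Quotient.lift₂ (s₁ := Formula.setoid V) (s₂ := Formula.setoid V)
    (fun φ ψ => mk (imp (neg φ) ψ))
    (fun _ _ _ _ h h' => mk_eq (imp_congr (neg_congr h) h'))

/-- `[φ]* = [¬φ]`. -/
def compl {V : Type*} : Lindenbaum V → Lindenbaum V :=
  Quotient.lift (s := Formula.setoid V) (fun φ => mk (neg φ)) (fun _ _ h => mk_eq (neg_congr h))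

/-- `r [φ] = [Δ_r φ]`. -/
def scal {V : Type*} (r : unitInterval) : Lindenbaum V → Lindenbaum V :=
  Quotient.lift (s := Formula.setoid V) (fun φ => mk (delta r φ))
    (fun _ _ h => mk_eq (neg_congr (nabla_congr r (neg_congr h))))

/-- `0 = [¬(v → v)]`, for a chosen variable `v`. -/
def zero {V : Type*} [Inhabited V] : Lindenbaum V :=
  mk (neg (imp (var default) (var default)))

section laws

variable {V : Type*}

theorem mk_neg_neg (φ : Formula V) : mk (neg (neg φ)) = mk φ :=
  mk_eq ⟨Provable.neg_neg φ, Provable.to_neg_neg φ⟩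

theorem mk_imp {φ φ' ψ ψ' : Formula V} (h : mk φ = mk φ') (h' : mk ψ = mk ψ') :
    mk (imp φ ψ) = mk (imp φ' ψ') :=
  mk_eq (imp_congr (Quotient.exact (s := Formula.setoid V) h)
    (Quotient.exact (s := Formula.setoid V) h'))

theorem mk_neg {φ ψ : Formula V} (h : mk φ = mk ψ) : mk (neg φ) = mk (neg ψ) :=
  mk_eq (neg_congr (Quotient.exact (s := Formula.setoid V) h))

theorem mk_nabla (r : unitInterval) {φ ψ : Formula V} (h : mk φ = mk ψ) :
    mk (nabla r φ) = mk (nabla r ψ) :=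
  mk_eq (nabla_congr r (Quotient.exact (s := Formula.setoid V) h))

theorem mk_contra (φ ψ : Formula V) : mk (imp (neg ψ) (neg φ)) = mk (imp φ ψ) :=
  mk_eq ⟨Provable.luk4 _ _, Provable.contra _ _⟩

theorem mk_exchange (φ ψ χ : Formula V) :
    mk (imp φ (imp ψ χ)) = mk (imp ψ (imp φ χ)) :=
  mk_eq ⟨Provable.exchange _ _ _, Provable.exchange _ _ _⟩

theorem mk_provable {φ ψ : Formula V} (h : Provable φ) (h' : Provable ψ) : mk φ = mk ψ :=
  mk_eq ⟨Provable.mp h' (Provable.luk1 ψ φ), Provable.mp h (Provable.luk1 φ ψ)⟩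

theorem mk_comm (φ ψ : Formula V) : mk (imp (neg φ) ψ) = mk (imp (neg ψ) φ) :=
  (mk_contra (neg φ) ψ).symm.trans (mk_imp rfl (mk_neg_neg φ))

theorem mk_odot_neg (φ ψ : Formula V) :
    mk (neg (imp (neg (neg φ)) (neg (neg ψ)))) = mk (neg (imp φ ψ)) :=
  mk_neg (mk_imp (mk_neg_neg φ) (mk_neg_neg ψ))

end laws

/-- The Lindenbaum-Tarski algebra is a Riesz MV-algebra. -/
instance rieszMV {V : Type*} [Inhabited V] : RieszMVAlgebra (Lindenbaum V) where
  oplus := oplus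
  neg := compl
  zero := zero
  scal := scal
  oplus_assoc := by
    rintro ⟨x⟩ ⟨y⟩ ⟨z⟩
    change mk (imp (neg (imp (neg x) y)) z) = mk (imp (neg x) (imp (neg y) z))
    rw [mk_comm, mk_exchange]
    exact mk_imp rfl (mk_comm z y)
  oplus_comm := by
    rintro ⟨x⟩ ⟨y⟩
    exact mk_comm x y
  oplus_zero := by
    rintro ⟨x⟩
    change mk (imp (neg x) (neg (imp (var default) (var default)))) = mk x
    rw [mk_contra]
    exact mk_eq ⟨Provable.mp (Provable.refl _) (Provable.assertion _ _), Provable.luk1 _ _⟩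
  neg_neg := by
    rintro ⟨x⟩
    exact mk_neg_neg x
  neg_zero_oplus := by
    rintro ⟨x⟩
    change mk (imp (neg (neg (neg (imp (var default) (var default))))) x)
      = mk (neg (neg (imp (var default) (var default))))
    have h : Provable (neg (neg (imp (var (default : V)) (var default)))) :=
      Provable.mp (Provable.refl _) (Provable.to_neg_neg _)
    rw [mk_comm]
    exact mk_provable (Provable.mp h (Provable.luk1 _ _)) h
  oplus_neg_oplus := by
    rintro ⟨x⟩ ⟨y⟩
    change mk (imp (neg (neg (imp (neg (neg x)) y))) y)
      = mk (imp (neg (neg (imp (neg (neg y)) x))) x)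
    have h (a b : Formula V) :
        mk (imp (neg (neg (imp (neg (neg a)) b))) b) = mk (imp (imp a b) b) :=
      mk_imp ((mk_neg_neg _).trans (mk_imp (mk_neg_neg a) rfl)) rfl
    rw [h, h]
    exact mk_eq ⟨Provable.luk3 _ _, Provable.luk3 _ _⟩
  scal_odot_neg := by
    rintro r ⟨x⟩ ⟨y⟩
    change mk (neg (nabla r (neg (neg (imp (neg (neg x)) (neg (neg y)))))))
      = mk (neg (imp (neg (neg (delta r x))) (neg (neg (delta r y)))))
    rw [mk_odot_neg]
    refine mk_neg (((mk_nabla r ?_).trans (mk_eq (Provable.equiv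
      (Provable.rl1 r (neg y) (neg x))))).trans (mk_contra _ _).symm)
    rw [mk_neg_neg, mk_contra, mk_contra]
  odot_neg_scal := by
    rintro r q ⟨x⟩
    change mk (neg (nabla _ (neg x)))
      = mk (neg (imp (neg (neg (delta r x))) (neg (neg (delta q x)))))
    rw [mk_odot_neg]
    exact mk_neg ((mk_eq (Provable.equiv (Provable.rl2 r q (neg x)))).trans (mk_contra _ _).symm)
  scal_scal := by
    rintro r q ⟨x⟩
    change mk (neg (nabla r (neg (neg (nabla q (neg x)))))) = mk (neg (nabla (r * q) (neg x)))
    exact mk_neg ((mk_nabla r (mk_neg_neg _)).trans (mk_eq (Provable.equiv (Provable.rl3 r q _))))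
  one_scal := by
    rintro ⟨x⟩
    change mk (neg (nabla 1 (neg x))) = mk x
    exact (mk_neg (mk_eq (Provable.equiv (Provable.rl4 _)))).trans (mk_neg_neg x)

end Lindenbaum

namespace Formula

/-- An evaluation of the formulas in a Riesz MV-algebra. -/
structure IsEvaluation {V R : Type*} [RieszMVAlgebra R] (e : Formula V → R) : Prop where
  map_imp : ∀ φ ψ, e (imp φ ψ) = MVAlgebra.oplus (MVAlgebra.neg (e φ)) (e ψ)
  map_neg : ∀ φ, e (neg φ) = MVAlgebra.neg (e φ)
  map_nabla : ∀ r φ,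
    e (nabla r φ) = MVAlgebra.neg (RieszMVAlgebra.scal r (MVAlgebra.neg (e φ)))

/-- The evaluation determined by the values of the variables. -/
def eval {V R : Type*} [RieszMVAlgebra R] (v : V → R) : Formula V → R
  | var i => v i
  | neg φ => MVAlgebra.neg (eval v φ)
  | imp φ ψ => MVAlgebra.oplus (MVAlgebra.neg (eval v φ)) (eval v ψ)
  | nabla r φ => MVAlgebra.neg (RieszMVAlgebra.scal r (MVAlgebra.neg (eval v φ)))

theorem isEvaluation_eval {V R : Type*} [RieszMVAlgebra R] (v : V → R) :
    IsEvaluation (eval v) :=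
  ⟨fun _ _ => rfl, fun _ => rfl, fun _ _ => rfl⟩

theorem IsEvaluation.eq_eval {V R : Type*} [RieszMVAlgebra R] {e : Formula V → R}
    (he : IsEvaluation e) (φ : Formula V) : e φ = eval (fun i => e (var i)) φ := by
  induction φ with
  | var i => rfl
  | neg φ ih => rw [he.map_neg, ih]; rfl
  | imp φ ψ ih ih' => rw [he.map_imp, ih, ih']; rfl
  | nabla r φ ih => rw [he.map_nabla, ih]; rfl

/-- The term function `[0,1]ⁿ → [0,1]` of a formula with variables `v₁, …, vₙ`. -/
noncomputable def termFun {n : ℕ} (φ : Formula (Fin n)) (x : Fin n → unitInterval) :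
    unitInterval :=
  eval x φ

/-- A formula is invalid if some `[0,1]`-valued evaluation sends it to `0`. -/
def Invalid {V : Type*} (φ : Formula V) : Prop :=
  ∃ e : Formula V → unitInterval, IsEvaluation e ∧ e φ = 0

/-- The book `{(φᵢ, rᵢ)}` is coherent if for all real `c₁, …, cₖ` some `[0,1]`-valued evaluation
`e` satisfies `∑ cᵢ (rᵢ - e(φᵢ)) ≥ 0`. -/
def IsCoherentBook {V : Type*} {k : ℕ} (φ : Fin k → Formula V) (r : Fin k → unitInterval) :
    Prop :=
  ∀ c : Fin k → ℝ, ∃ e : Formula V → unitInterval, IsEvaluation e ∧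
    0 ≤ ∑ i, c i * ((r i : ℝ) - (e (φ i) : ℝ))

/-- The truncation `(x ∨ 0) ∧ 1` of a real number to `[0,1]`. -/
noncomputable def trunc (x : ℝ) : ℝ := min (max x 0) 1

/-- The quasi-linear span of `f₁, …, fₖ : [0,1]ⁿ → ℝ`: all formulas whose term function is the
truncation of some real linear combination of `f₁, …, fₖ`. (It is used for continuous piecewise
linear functions; nothing in the definition depends on that.) -/
def quasiLinearSpan {n k : ℕ} (f : Fin k → (Fin n → unitInterval) → ℝ) :
    Set (Formula (Fin n)) :=
  {φ | ∃ c : Fin k → ℝ, ∀ x, (termFun φ x : ℝ) = trunc (∑ i, c i * f i x)}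

end Formula

/-! A vector of values is coherent exactly when no linear functional separates it strictly from the
set of vectors `(e (x i))`, with `e` ranging over the MV-morphisms to `[0,1]`. These morphisms form
a closed subset of a Tychonoff cube, so that set and its convex hull are compact. Hahn-Banach and
Carathéodory then write a coherent vector as a convex combination of at most `k + 1` value vectors
(`exists_convex_combination_of_coherent`). Such a combination of morphisms is a state.

Conversely, states are coherent (`IsState.coherent`). A linear combination of the `x i` is
represented, up to a shift and a positive factor, by one element `P`, so it suffices to find a
morphism `e` with `e P ≤ s P`. This amounts to killing `P ∸ const (s P)`. No multiple of that
element is `1`, since `s` would then be inconsistent, and `exists_isMVHom_eq_zero` applies: a prime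
ideal containing the element makes the quotient a chain, and the position of each element among the
constants gives a real value.

Morphisms of MV-algebras to `[0,1]` preserve scalars automatically, because bounded additive
functions are linear. Hence morphisms on the Lindenbaum-Tarski algebra are the same as evaluations,
and the statement on books follows. For quasi-linear combinations, the truncation of a combination
is itself a term function, and it vanishes exactly where the combination is nonpositive. -/

namespace MVAlgebra

/-! ### Arithmetic, order and disjointness in MV-algebras. -/

/-- Truncated difference `x ⊖ y = (x* ⊕ y)*`. -/
def diff {A : Type*} [MVAlgebra A] (x y : A) : A := neg (oplus (neg x) y)

/-- The natural order of an MV-algebra: `x ≤ y` if `x* ⊕ y = 1`. -/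
def Le {A : Type*} [MVAlgebra A] (x y : A) : Prop := oplus (neg x) y = one

/-- `n`-fold sum `x ⊕ ⋯ ⊕ x`. -/
def nmul {A : Type*} [MVAlgebra A] : ℕ → A → A
  | 0, _ => zero
  | n + 1, x => oplus (nmul n x) x

/-- Two elements are disjoint if `0` is their only common lower bound. -/
def Disj {A : Type*} [MVAlgebra A] (x y : A) : Prop := ∀ w, Le w x → Le w y → w = zero

local infixl:65 " ∔ " => oplus
local infixl:65 " ∸ " => diff
local infix:50 " ≼ " => Le

section basics

variable {A : Type*} [MVAlgebra A] {x y z w : A}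

instance : Std.Associative (oplus : A → A → A) := ⟨oplus_assoc⟩
instance : Std.Commutative (oplus : A → A → A) := ⟨oplus_comm⟩

theorem neg_one : neg (one : A) = zero := neg_neg _

theorem neg_zero : neg (zero : A) = one := rfl

theorem one_oplus (x : A) : one ∔ x = one := neg_zero_oplus x

theorem oplus_one (x : A) : x ∔ one = one := by rw [oplus_comm, one_oplus]

theorem zero_oplus (x : A) : zero ∔ x = x := by rw [oplus_comm, oplus_zero]

theorem neg_oplus_self (x : A) : neg x ∔ x = one := by
  have h := oplus_neg_oplus x one
  rwa [oplus_one, neg_one, zero_oplus, eq_comm] at h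

theorem neg_diff (x y : A) : neg (x ∸ y) = neg x ∔ y := neg_neg _

theorem diff_oplus_comm (x y : A) : (x ∸ y) ∔ y = (y ∸ x) ∔ x := oplus_neg_oplus x y

theorem one_diff (x : A) : one ∸ x = neg x := by rw [diff, neg_one, zero_oplus]

theorem diff_zero (x : A) : x ∸ zero = x := by rw [diff, oplus_zero, neg_neg]

theorem diff_self (x : A) : x ∸ x = zero := by rw [diff, neg_oplus_self, neg_one]

/-- All operations can be recovered from `∸` and `one`, so morphisms need only be tested on these
two. -/
theorem oplus_eq_diff (x y : A) : x ∔ y = one ∸ ((one ∸ x) ∸ y) := by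
  rw [one_diff, one_diff, neg_diff, neg_neg]

theorem odot_neg_eq_diff (x y : A) : odot x (neg y) = x ∸ y := by
  rw [odot, neg_neg, diff]

theorem odot_eq_diff (x y : A) : odot x y = x ∸ neg y := rfl

theorem le_iff_diff : x ≼ y ↔ x ∸ y = zero :=
  ⟨fun h => by rw [diff, h, neg_one], fun h => by rw [Le, ← neg_diff, h]; rfl⟩

theorem Le.refl (x : A) : x ≼ x := neg_oplus_self x

theorem Le.diff_oplus (h : x ≼ y) : (y ∸ x) ∔ x = y := by
  rw [← diff_oplus_comm, le_iff_diff.1 h, zero_oplus]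

theorem le_oplus_right (x y : A) : x ≼ x ∔ y := by
  rw [Le, ← oplus_assoc, neg_oplus_self, one_oplus]

theorem le_oplus_left (x y : A) : y ≼ x ∔ y := by
  rw [oplus_comm]; exact le_oplus_right y x

theorem Le.trans (h : x ≼ y) (h' : y ≼ z) : x ≼ z := by
  rw [← h'.diff_oplus, ← h.diff_oplus, ← oplus_assoc]
  exact le_oplus_left _ _

theorem Le.antisymm (h : x ≼ y) (h' : y ≼ x) : x = y := by
  rw [← h.diff_oplus, le_iff_diff.1 h', zero_oplus]

theorem zero_le (x : A) : zero ≼ x := one_oplus x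

theorem le_one (x : A) : x ≼ one := oplus_one _

theorem Le.eq_zero (h : x ≼ zero) : x = zero := h.antisymm (zero_le x)

theorem Le.oplus (h : x ≼ y) (h' : z ≼ w) : x ∔ z ≼ y ∔ w := by
  rw [← h.diff_oplus, ← h'.diff_oplus]
  have : (y ∸ x) ∔ x ∔ ((w ∸ z) ∔ z) = ((y ∸ x) ∔ (w ∸ z)) ∔ (x ∔ z) := by ac_rfl
  rw [this]
  exact le_oplus_left _ _

theorem diff_le_iff : x ∸ y ≼ z ↔ x ≼ y ∔ z := by
  rw [Le, Le, neg_diff, oplus_assoc]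

theorem neg_le_neg_iff : neg x ≼ neg y ↔ y ≼ x := by
  rw [Le, Le, neg_neg, oplus_comm]

theorem le_diff_oplus (x y : A) : x ≼ (x ∸ y) ∔ y := by
  rw [oplus_comm, ← diff_le_iff]; exact Le.refl _

theorem diff_le (x y : A) : x ∸ y ≼ x := diff_le_iff.2 (le_oplus_left _ _)

theorem diff_oplus_le (h : x ≼ z) (h' : y ≼ z) : (x ∸ y) ∔ y ≼ z := by
  rw [← h'.diff_oplus]
  refine Le.oplus (diff_le_iff.2 ?_) (Le.refl y)
  rwa [oplus_comm, h'.diff_oplus]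

theorem odot_comm (x y : A) : odot x y = odot y x := by
  rw [odot, odot, oplus_comm]

theorem odot_assoc (x y z : A) : odot (odot x y) z = odot x (odot y z) := by
  simp only [odot, neg_neg, oplus_assoc]

instance : Std.Associative (odot : A → A → A) := ⟨odot_assoc⟩
instance : Std.Commutative (odot : A → A → A) := ⟨odot_comm⟩

theorem odot_neg_self (x : A) : odot x (neg x) = zero := by
  rw [odot_neg_eq_diff, diff_self]

theorem odot_zero (x : A) : odot x zero = zero := by
  rw [odot, neg_zero, oplus_one, neg_one]

/-- Both sides are the meet of `x` and `y`; this is the dual of the last MV axiom. -/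
theorem odot_neg_oplus_comm (x y : A) :
    odot x (neg x ∔ y) = odot y (neg y ∔ x) := by
  have h := oplus_neg_oplus (neg y) (neg x)
  rw [neg_neg, neg_neg] at h
  rw [odot, odot, oplus_comm (neg x), oplus_comm (neg x), h,
    oplus_comm (neg y) x, oplus_comm (neg y)]

theorem le_odot_neg_oplus (h : w ≼ x) (h' : w ≼ y) : w ≼ odot x (neg x ∔ y) := by
  rw [← neg_le_neg_iff, odot, neg_neg, oplus_comm, oplus_comm (neg x) y]
  have e : neg (y ∔ neg x) = neg y ∸ neg x := by rw [diff, neg_neg]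
  rw [e]
  exact diff_oplus_le (neg_le_neg_iff.2 h') (neg_le_neg_iff.2 h)

theorem Disj.symm (h : Disj x y) : Disj y x := fun w h1 h2 => h w h2 h1

/-- The source of prelinearity: it makes quotients by prime ideals totally ordered. The meet of the
two differences is rewritten, by repeatedly exchanging the roles in a meet, until a factor `y ⊙ y*`
appears. -/
theorem disj_diff_diff (x y : A) : Disj (x ∸ y) (y ∸ x) := by
  intro w h h'
  have key : odot (x ∸ y) (neg (x ∸ y) ∔ (y ∸ x)) = zero := by
    rw [neg_diff, ← odot_neg_eq_diff x, ← odot_neg_eq_diff y]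
    set v := odot y (neg x) with hv
    have hq : neg (y ∔ v) = odot (neg y) (neg v) := by rw [odot, neg_neg, neg_neg]
    calc odot (odot x (neg y)) (neg x ∔ y ∔ v)
        = odot (neg y) (odot x (neg x ∔ (y ∔ v))) := by rw [oplus_assoc]; ac_rfl
      _ = odot (odot (neg y) (neg (neg y) ∔ v)) (neg (y ∔ v) ∔ x) := by
          rw [odot_neg_oplus_comm, neg_neg]; ac_rfl
      _ = odot (odot y (neg v ∔ neg y)) (odot (neg x) (neg (neg x) ∔ neg (y ∔ v))) := by
          rw [odot_neg_oplus_comm (neg y) v, neg_neg, oplus_comm (neg (y ∔ v)) x]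
          nth_rewrite 1 [hv]
          ac_rfl
      _ = odot (odot y (neg y)) (odot (odot (neg v) (neg v ∔ neg y))
            (neg (neg (y ∔ v)) ∔ neg x)) := by
          rw [odot_neg_oplus_comm (neg x), hq]; ac_rfl
      _ = zero := by rw [odot_neg_self, odot_comm, odot_zero]
  exact (key ▸ le_odot_neg_oplus h h').eq_zero

/-- If `w` lies below `x ∔ y` and `z`, then `w ∸ x` lies below `y` and `z`, hence is zero, so `w`
already lies below `x`. -/
theorem Disj.oplus (h : Disj x z) (h' : Disj y z) : Disj (x ∔ y) z := by
  intro w hw hz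
  exact h w (le_iff_diff.2 (h' _ (diff_le_iff.2 hw) ((diff_le _ _).trans hz))) hz

theorem zero_disj (x : A) : Disj zero x := fun _ h _ => h.eq_zero

theorem Disj.nmul (h : Disj x y) (n : ℕ) : Disj (nmul n x) y := by
  induction n with
  | zero => exact zero_disj y
  | succ n ih => exact ih.oplus h

theorem nmul_add (m n : ℕ) (x : A) : nmul (m + n) x = nmul m x ∔ nmul n x := by
  induction n with
  | zero => exact (oplus_zero _).symm
  | succ n ih => rw [← Nat.add_assoc, MVAlgebra.nmul, ih, oplus_assoc]; rfl

end basics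

end MVAlgebra

/-! ### Morphisms and the standard algebra. -/

open MVAlgebra in
theorem IsMVHom.of_diff {A B : Type*} [MVAlgebra A] [MVAlgebra B] {f : A → B}
    (h1 : f one = one) (hd : ∀ x y, f (diff x y) = diff (f x) (f y)) : IsMVHom f where
  map_zero := by rw [← diff_self (one : A), hd, diff_self]
  map_oplus x y := by rw [oplus_eq_diff, hd, hd, hd, h1, ← oplus_eq_diff]
  map_neg x := by rw [← one_diff, hd, h1, one_diff]

namespace IsMVHom

open MVAlgebra

variable {A B : Type*} [MVAlgebra A] [MVAlgebra B] {f : A → B}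

theorem map_one (h : IsMVHom f) : f one = one := by rw [one, h.map_neg, h.map_zero]; rfl

theorem map_diff (h : IsMVHom f) (x y : A) : f (diff x y) = diff (f x) (f y) := by
  rw [diff, h.map_neg, h.map_oplus, h.map_neg]; rfl

theorem map_nmul (h : IsMVHom f) (n : ℕ) (x : A) : f (nmul n x) = nmul n (f x) := by
  induction n with
  | zero => exact h.map_zero
  | succ n ih => rw [nmul, h.map_oplus, ih]; rfl

end IsMVHom

namespace unitInterval

open MVAlgebra

theorem coe_oplus (x y : unitInterval) : ((oplus x y : unitInterval) : ℝ) = min ((x : ℝ) + y) 1 :=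
  rfl

theorem coe_mvNeg (x : unitInterval) : ((MVAlgebra.neg x : unitInterval) : ℝ) = 1 - x := rfl

theorem mvZero_eq : (MVAlgebra.zero : unitInterval) = 0 := rfl

theorem mvOne_eq : (MVAlgebra.one : unitInterval) = 1 :=
  Subtype.ext (by simp [one, coe_mvNeg, mvZero_eq])

theorem coe_diff (x y : unitInterval) : ((diff x y : unitInterval) : ℝ) = max ((x : ℝ) - y) 0 := by
  rw [← odot_neg_eq_diff, coe_odot_neg]

theorem coe_scal (r x : unitInterval) : ((RieszMVAlgebra.scal r x : unitInterval) : ℝ) = r * x :=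
  rfl

theorem coe_nmul (n : ℕ) (x : unitInterval) :
    ((nmul n x : unitInterval) : ℝ) = min (n * (x : ℝ)) 1 := by
  have hx := x.2.1
  induction n with
  | zero => simp [nmul, mvZero_eq]
  | succ n ih =>
    rw [nmul, coe_oplus, ih]
    push_cast
    rw [add_mul, one_mul]
    rcases min_cases ((n : ℝ) * x) 1 with h | h
    · rw [h.1]
    · rw [h.1, min_eq_right, min_eq_right] <;> linarith

theorem mvLe_iff (x y : unitInterval) : Le x y ↔ x ≤ y := by
  rw [le_iff_diff, ← Subtype.coe_inj, coe_diff, mvZero_eq, Set.Icc.coe_zero, max_eq_right_iff,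
    sub_nonpos, Subtype.coe_le_coe]

end unitInterval

/-! ### Ideals and prime ideals. -/

namespace MVAlgebra

local infixl:65 " ∔ " => oplus
local infixl:65 " ∸ " => diff
local infix:50 " ≼ " => Le

/-- Ideals of an MV-algebra. -/
structure IsIdeal {A : Type*} [MVAlgebra A] (I : Set A) : Prop where
  zero_mem : zero ∈ I
  oplus_mem : ∀ {x y}, x ∈ I → y ∈ I → x ∔ y ∈ I
  mem_of_le : ∀ {x y}, x ≼ y → y ∈ I → x ∈ I

namespace IsIdeal

variable {A : Type*} [MVAlgebra A] {I : Set A}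

theorem singleton_zero : IsIdeal ({zero} : Set A) where
  zero_mem := rfl
  oplus_mem := by
    rintro _ _ rfl rfl
    exact oplus_zero _
  mem_of_le := by
    rintro x _ h rfl
    exact h.eq_zero

theorem nmul_mem (hI : IsIdeal I) {x : A} (hx : x ∈ I) (n : ℕ) : nmul n x ∈ I := by
  induction n with
  | zero => exact hI.zero_mem
  | succ n ih => exact hI.oplus_mem ih hx

/-- The ideal generated by `I` and `a`. -/
theorem adjoin (hI : IsIdeal I) (a : A) :
    IsIdeal {z | ∃ n : ℕ, ∃ i ∈ I, z ≼ nmul n a ∔ i} where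
  zero_mem := ⟨0, zero, hI.zero_mem, zero_le _⟩
  oplus_mem := by
    rintro x y ⟨n, i, hi, hx⟩ ⟨m, j, hj, hy⟩
    refine ⟨n + m, i ∔ j, hI.oplus_mem hi hj, ?_⟩
    have e : nmul (n + m) a ∔ (i ∔ j) = (nmul n a ∔ i) ∔ (nmul m a ∔ j) := by
      rw [nmul_add]; ac_rfl
    rw [e]
    exact hx.oplus hy
  mem_of_le := by
    rintro x y h ⟨n, i, hi, hy⟩
    exact ⟨n, i, hi, h.trans hy⟩

/-- An ideal that is maximal among those avoiding `1` is prime. -/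
theorem mem_or_mem_of_disj (hI : IsIdeal I)
    (hmax : ∀ J : Set A, IsIdeal J → one ∉ J → I ⊆ J → J = I) (h1 : one ∉ I)
    {a b : A} (hab : Disj a b) : a ∈ I ∨ b ∈ I := by
  -- By maximality, adjoining an element outside `I` produces `1`.
  have key : ∀ c : A, c ∉ I → ∃ n : ℕ, ∃ i ∈ I, one ≼ nmul n c ∔ i := by
    intro c hc
    by_contra hne
    refine hc ((Set.ext_iff.1 (hmax _ (hI.adjoin c) hne
      fun i hi => ⟨0, i, hi, le_oplus_left _ _⟩) c).1 ?_)
    refine ⟨1, zero, hI.zero_mem, ?_⟩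
    rw [oplus_zero, nmul, nmul, zero_oplus]
    exact Le.refl c
  by_contra! hne
  obtain ⟨n, i, hi, hn⟩ := key a hne.1
  obtain ⟨m, j, hj, hm⟩ := key b hne.2
  have hd : Disj (nmul n a) (nmul m b) := ((hab.nmul n).symm.nmul m).symm
  -- This element lies below a multiple of `a` and a multiple of `b`, which are still disjoint.
  have hk : one ∸ (i ∔ j) = zero := by
    refine hd _ (diff_le_iff.2 (hn.trans ?_)) (diff_le_iff.2 (hm.trans ?_))
    · rw [oplus_comm]
      exact (le_oplus_right i j).oplus (Le.refl _)
    · rw [oplus_comm]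
      exact (le_oplus_left i j).oplus (Le.refl _)
  exact h1 (hI.mem_of_le (le_iff_diff.2 hk) (hI.oplus_mem hi hj))

/-- Every ideal avoiding `1` extends to a prime ideal avoiding `1`. -/
theorem exists_prime (hI : IsIdeal I) (h1 : one ∉ I) :
    ∃ J : Set A, IsIdeal J ∧ one ∉ J ∧ I ⊆ J ∧ ∀ x y : A, x ∸ y ∈ J ∨ y ∸ x ∈ J := by
  obtain ⟨J, hIJ, hJ⟩ := zorn_subset_nonempty {J : Set A | IsIdeal J ∧ one ∉ J} (by
    intro c hc hchain hne
    refine ⟨⋃₀ c, ⟨⟨?_, ?_, ?_⟩, ?_⟩, fun s hs => Set.subset_sUnion_of_mem hs⟩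
    · obtain ⟨s, hs⟩ := hne
      exact ⟨s, hs, (hc hs).1.zero_mem⟩
    · rintro x y ⟨s, hs, hx⟩ ⟨t, ht, hy⟩
      rcases hchain.total hs ht with h | h
      · exact ⟨t, ht, (hc ht).1.oplus_mem (h hx) hy⟩
      · exact ⟨s, hs, (hc hs).1.oplus_mem hx (h hy)⟩
    · rintro x y h ⟨s, hs, hy⟩
      exact ⟨s, hs, (hc hs).1.mem_of_le h hy⟩
    · rintro ⟨s, hs, h⟩
      exact (hc hs).2 h) I ⟨hI, h1⟩
  refine ⟨J, hJ.prop.1, hJ.prop.2, hIJ, fun x y => ?_⟩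
  exact hJ.prop.1.mem_or_mem_of_disj (fun K hK hK1 hJK => (hJ.eq_of_subset ⟨hK, hK1⟩ hJK).symm)
    hJ.prop.2 (disj_diff_diff x y)

end IsIdeal

end MVAlgebra

/-! ### Constants, and morphisms to `[0,1]` from prime ideals. -/

namespace RieszMVAlgebra

open MVAlgebra

local infixl:65 " ∔ " => oplus
local infixl:65 " ∸ " => diff
local infix:50 " ≼ " => Le

variable {R : Type*} [RieszMVAlgebra R]

theorem scal_diff (r : unitInterval) (x y : R) : scal r (x ∸ y) = scal r x ∸ scal r y := by
  rw [← odot_neg_eq_diff, scal_odot_neg, odot_neg_eq_diff]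

theorem diff_scal (r q : unitInterval) (x : R) : scal (r ∸ q) x = scal r x ∸ scal q x := by
  rw [← odot_neg_eq_diff, odot_neg_scal, odot_neg_eq_diff]

theorem scal_mono (r : unitInterval) {x y : R} (h : x ≼ y) : scal r x ≼ scal r y := by
  rw [le_iff_diff, ← scal_diff, le_iff_diff.1 h, ← diff_self (zero : R), scal_diff, diff_self,
    diff_self]

/-- The constant `r · 1`. -/
def const (r : unitInterval) : R := scal r one

theorem isMVHom_const : IsMVHom (const : unitInterval → R) :=
  IsMVHom.of_diff (by rw [unitInterval.mvOne_eq, const, one_scal])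
    fun r q => by simp only [const, diff_scal]

theorem const_zero : (const 0 : R) = zero := isMVHom_const.map_zero

theorem const_one : (const 1 : R) = one := one_scal one

/-- A nonzero constant has a multiple equal to `1`. -/
theorem exists_nmul_const_eq_one {r : unitInterval} (hr : 0 < r) :
    ∃ n : ℕ, nmul n (const r : R) = one := by
  have hr' : (0 : ℝ) < r := hr
  obtain ⟨n, hn⟩ := exists_nat_gt (1 / (r : ℝ))
  refine ⟨n, ?_⟩
  rw [← isMVHom_const.map_nmul, ← const_one]
  congr 1
  apply Subtype.ext
  rw [unitInterval.coe_nmul]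
  exact min_eq_right ((div_lt_iff₀ hr').1 hn).le

section order

variable {I : Set R} (hI : IsIdeal I)
include hI

/-- Membership of `x ∸ y` in `I` means `x ≤ y` modulo `I`; this is transitivity of that relation. -/
theorem diff_mem_trans {x y z : R} (h : x ∸ y ∈ I) (h' : y ∸ z ∈ I) : x ∸ z ∈ I := by
  refine hI.mem_of_le (diff_le_iff.2 ?_) (hI.oplus_mem h h')
  have e : z ∔ ((x ∸ y) ∔ (y ∸ z)) = (x ∸ y) ∔ ((y ∸ z) ∔ z) := by ac_rfl
  rw [e]
  exact (le_diff_oplus x y).trans ((Le.refl _).oplus (le_diff_oplus y z))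

/-- Modulo `I`, the difference is increasing in its first argument and decreasing in its second. -/
theorem diff_diff_mem {x x' y y' : R} (h : x ∸ x' ∈ I) (h' : y' ∸ y ∈ I) :
    (x ∸ y) ∸ (x' ∸ y') ∈ I := by
  refine hI.mem_of_le (diff_le_iff.2 (diff_le_iff.2 ?_)) (hI.oplus_mem h h')
  have e : y ∔ ((x' ∸ y') ∔ ((x ∸ x') ∔ (y' ∸ y))) =
    (x ∸ x') ∔ ((x' ∸ y') ∔ ((y' ∸ y) ∔ y)) := by ac_rfl
  rw [e]
  exact (le_diff_oplus x x').trans ((Le.refl _).oplus ((le_diff_oplus x' y').trans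
    ((Le.refl _).oplus (le_diff_oplus y' y))))

/-- A proper ideal contains no nonzero constant, since some multiple of such a constant is `1`. The
order of the constants therefore survives modulo `I`. -/
theorem le_of_const_diff_mem (h1 : one ∉ I) {r q : unitInterval}
    (h : (const r : R) ∸ const q ∈ I) : r ≤ q := by
  by_contra! hlt
  have hd : 0 < r ∸ q := by
    rw [← Subtype.coe_lt_coe, unitInterval.coe_diff]
    exact lt_max_of_lt_left (sub_pos.2 hlt)
  obtain ⟨n, hn⟩ := exists_nmul_const_eq_one (R := R) hd
  rw [← isMVHom_const.map_diff] at h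
  exact h1 (hn ▸ hI.nmul_mem h n)

/-- Modulo `I` each element cuts the chain of constants. The supremum of the constants below it
locates it up to every positive `d`, that is, up to infinitesimals. -/
theorem exists_value (htot : ∀ x y : R, x ∸ y ∈ I ∨ y ∸ x ∈ I) (x : R) :
    ∃ v : unitInterval, ∀ d : unitInterval, 0 < d →
      x ∸ const (v ∔ d) ∈ I ∧ const (v ∸ d) ∸ x ∈ I := by
  set S : Set unitInterval := {r | const r ∸ x ∈ I} with hS
  have h0 : const 0 ∸ x ∈ I := by
    rw [const_zero, le_iff_diff.1 (zero_le x)]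
    exact hI.zero_mem
  have hlub : IsLUB S (sSup S) := isLUB_sSup S
  refine ⟨sSup S, fun d hd => ⟨?_, ?_⟩⟩
  · rcases htot x (const (sSup S ∔ d)) with h | h
    · exact h
    · have hle : sSup S ∔ d ≤ sSup S := hlub.1 h
      -- Not exceeding the supremum despite `0 < d` is possible only because the sum was truncated
      -- at `1`.
      have he : sSup S ∔ d = 1 := by
        apply Subtype.ext
        have h2 : ((sSup S ∔ d : unitInterval) : ℝ) ≤ (sSup S : unitInterval) := hle
        have hd' : (0 : ℝ) < d := hd
        rw [unitInterval.coe_oplus] at h2 ⊢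
        rcases min_cases (((sSup S : unitInterval) : ℝ) + d) 1 with h3 | h3
        · linarith [h3.1]
        · exact h3.1
      rw [he, const_one, le_iff_diff.1 (le_one x)]
      exact hI.zero_mem
  · rcases eq_or_lt_of_le (unitInterval.nonneg' (t := sSup S ∸ d)) with h | h
    · rwa [← h]
    · have hlt : sSup S ∸ d < sSup S := by
        rw [← Subtype.coe_lt_coe, unitInterval.coe_diff, Set.Icc.coe_zero] at h
        rw [← Subtype.coe_lt_coe, unitInterval.coe_diff]
        have hd' : (0 : ℝ) < d := hd
        rcases lt_max_iff.1 h with h3 | h3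
        · rw [max_eq_left h3.le]; linarith
        · exact absurd h3 (lt_irrefl _)
      obtain ⟨r, hr, hlr, -⟩ := hlub.exists_between hlt
      refine diff_mem_trans hI ?_ hr
      rw [← isMVHom_const.map_diff, le_iff_diff.1 ((unitInterval.mvLe_iff _ _).2 hlr.le),
        isMVHom_const.map_zero]
      exact hI.zero_mem

end order

/-- An element no multiple of which is `1` vanishes under some morphism to `[0,1]`. -/
theorem exists_isMVHom_eq_zero {a : R} (ha : ∀ n : ℕ, nmul n a ≠ one) :
    ∃ e : R → unitInterval, IsMVHom e ∧ e a = 0 := by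
  have hproper : one ∉ {z | ∃ n : ℕ, ∃ i ∈ ({zero} : Set R), z ≼ nmul n a ∔ i} := by
    rintro ⟨n, _, rfl, h⟩
    rw [oplus_zero] at h
    exact ha n ((le_one _).antisymm h)
  obtain ⟨I, hI, h1, haI, htot⟩ := (IsIdeal.singleton_zero.adjoin a).exists_prime hproper
  have haI : a ∈ I := haI ⟨1, zero, rfl, by
    rw [oplus_zero, nmul, nmul, zero_oplus]; exact Le.refl a⟩
  choose v hv using exists_value hI htot
  have hle : ∀ {x : R} {r q : unitInterval}, const r ∸ x ∈ I → x ∸ const q ∈ I → r ≤ q :=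
    fun h h' => le_of_const_diff_mem hI h1 (diff_mem_trans hI h h')
  have upper : ∀ {x : R} {q : unitInterval}, x ∸ const q ∈ I → ∀ d : unitInterval, 0 < d →
      (v x : ℝ) ≤ q + d := by
    intro x q h d hd
    have h2 : ((v x ∸ d : unitInterval) : ℝ) ≤ q := hle (hv x d hd).2 h
    rw [unitInterval.coe_diff] at h2
    linarith [le_max_left ((v x : ℝ) - d) 0]
  have lower : ∀ {x : R} {q : unitInterval}, const q ∸ x ∈ I → ∀ d : unitInterval, 0 < d →
      (q : ℝ) ≤ v x + d := by
    intro x q h d hd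
    have h2 : (q : ℝ) ≤ (v x ∔ d : unitInterval) := hle h (hv x d hd).1
    rw [unitInterval.coe_oplus] at h2
    exact h2.trans (min_le_left _ _)
  -- The factor 3 leaves room for one error `d` from each of `x`, `y` and `x ∸ y`. In the witness,
  -- dividing by 6 keeps `3 * d` below the gap `s - t`.
  have small : ∀ {s t : ℝ}, s ≤ 1 → 0 ≤ t →
      (∀ d : unitInterval, 0 < d → s ≤ t + 3 * d) → s ≤ t := by
    intro s t hs ht h
    by_contra! hlt
    have := h ⟨(s - t) / 6, by linarith, by linarith⟩
      (by rw [← Subtype.coe_lt_coe]; change (0 : ℝ) < (s - t) / 6; linarith)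
    simp only at this
    linarith
  refine ⟨v, IsMVHom.of_diff ?_ ?_, ?_⟩
  · rw [unitInterval.mvOne_eq]
    refine le_antisymm unitInterval.le_one' (small le_rfl (v one).2.1 fun d hd => ?_)
    have h := lower (x := one) (q := 1) (by
      rw [const_one, diff_self]; exact hI.zero_mem) d hd
    rw [Set.Icc.coe_one] at h
    have hd' : (0 : ℝ) < d := hd
    rw [Set.Icc.coe_one]
    linarith
  · intro x y
    refine le_antisymm (small (v _).2.2 (v x ∸ v y).2.1 fun d hd => ?_)
      (small (v x ∸ v y).2.2 (v _).2.1 fun d hd => ?_)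
    · have h := diff_diff_mem hI (hv x d hd).1 (hv y d hd).2
      rw [← isMVHom_const.map_diff] at h
      have h2 := upper h d hd
      refine h2.trans ?_
      have hd' : (0 : ℝ) < d := hd
      simp only [unitInterval.coe_diff, unitInterval.coe_oplus]
      have : max (min ((v x : ℝ) + d) 1 - max ((v y : ℝ) - d) 0) 0
          ≤ max ((v x : ℝ) - v y) 0 + 2 * d := by
        apply max_le
        · linarith [min_le_left ((v x : ℝ) + d) 1, le_max_left ((v y : ℝ) - d) 0,
            le_max_left ((v x : ℝ) - v y) 0]
        · linarith [le_max_right ((v x : ℝ) - v y) 0]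
      linarith
    · have h := diff_diff_mem hI (hv x d hd).2 (hv y d hd).1
      rw [← isMVHom_const.map_diff] at h
      have h2 := lower h d hd
      have hd' : (0 : ℝ) < d := hd
      simp only [unitInterval.coe_diff, unitInterval.coe_oplus] at h2 ⊢
      have h3 := (le_max_left _ _).trans h2
      apply max_le
      · linarith [min_le_left ((v y : ℝ) + d) 1, le_max_left ((v x : ℝ) - d) 0]
      · linarith [(v (x ∸ y)).2.1]
  · refine le_antisymm (small (v a).2.2 le_rfl fun d hd => ?_) unitInterval.nonneg'
    have h := upper (x := a) (q := 0) (by rwa [const_zero, diff_zero]) d hd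
    have hd' : (0 : ℝ) < d := hd
    linarith

end RieszMVAlgebra

/-! ### Automatic homogeneity of morphisms. -/

/-- A bounded additive function on `[0,1]` is linear. -/
theorem eq_mul_of_additive_of_bounded {g : ℝ → ℝ} {C : ℝ}
    (hadd : ∀ a b, 0 ≤ a → 0 ≤ b → a + b ≤ 1 → g (a + b) = g a + g b)
    (hC : ∀ a, 0 ≤ a → a ≤ 1 → |g a| ≤ C) {r : ℝ} (h0 : 0 ≤ r) (h1 : r ≤ 1) :
    g r = r * g 1 := by
  have hC1 := hC 1 zero_le_one le_rfl
  -- The defect `g a - a * g 1` doubles when `a ≤ 1 / 2` is doubled and changes sign under `a ↦ 1 -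
  -- a`. It is thus always half, in absolute value, of a defect elsewhere in `[0,1]`; iterating
  -- forces it to vanish.
  have step : ∀ a, 0 ≤ a → a ≤ 1 → ∃ b, 0 ≤ b ∧ b ≤ 1 ∧
      |g a - a * g 1| = |g b - b * g 1| / 2 := by
    have low : ∀ a, 0 ≤ a → a ≤ 1 / 2 → |g a - a * g 1| = |g (2 * a) - 2 * a * g 1| / 2 := by
      intro a ha ha'
      have h := hadd a a ha ha (by linarith)
      rw [← two_mul] at h
      have e : g (2 * a) - 2 * a * g 1 = 2 * (g a - a * g 1) := by rw [h]; ring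
      rw [e, abs_mul, abs_two]
      ring
    intro a ha ha'
    rcases le_total a (1 / 2) with h | h
    · exact ⟨2 * a, by linarith, by linarith, low a ha h⟩
    · refine ⟨2 * (1 - a), by linarith, by linarith, ?_⟩
      rw [← low (1 - a) (by linarith) (by linarith)]
      have h' := hadd a (1 - a) ha (by linarith) (by linarith)
      rw [add_sub_cancel] at h'
      rw [← abs_neg]
      congr 1
      linear_combination h'
  have bound : ∀ n : ℕ, ∀ a, 0 ≤ a → a ≤ 1 → |g a - a * g 1| ≤ 2 * C * (1 / 2) ^ n := by
    intro n
    induction n with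
    | zero =>
      intro a ha ha'
      have h1 := hC a ha ha'
      have h2 : |a * g 1| ≤ C := by
        rw [abs_mul, abs_of_nonneg ha]
        exact (mul_le_of_le_one_left (abs_nonneg _) ha').trans hC1
      rw [pow_zero, mul_one, two_mul]
      exact (abs_sub _ _).trans (add_le_add h1 h2)
    | succ n ih =>
      intro a ha ha'
      obtain ⟨b, hb, hb', e⟩ := step a ha ha'
      rw [e, pow_succ]
      linarith [ih b hb hb']
  have hlim : Filter.Tendsto (fun n : ℕ => 2 * C * (1 / 2 : ℝ) ^ n) Filter.atTop (nhds 0) := by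
    have h := (tendsto_pow_atTop_nhds_zero_of_lt_one (r := (1 / 2 : ℝ)) (by norm_num)
      (by norm_num)).const_mul (2 * C)
    rwa [mul_zero] at h
  have h := ge_of_tendsto' hlim fun n => bound n r h0 h1
  exact sub_eq_zero.1 (abs_eq_zero.1 (le_antisymm h (abs_nonneg _)))

open MVAlgebra RieszMVAlgebra

local infixl:65 " ∔ " => MVAlgebra.oplus
local infixl:65 " ∸ " => MVAlgebra.diff
local infix:50 " ≼ " => MVAlgebra.Le

namespace IsMVHom

variable {R : Type*} [RieszMVAlgebra R] {e : R → unitInterval}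

/-- Morphisms of MV-algebras to `[0,1]` preserve the scalar multiplication. -/
theorem isRieszMVHom (he : IsMVHom e) : IsRieszMVHom e where
  toIsMVHom := he
  map_scal r x := by
    have hd : ∀ r q : unitInterval, e (scal (r ∸ q) x) = e (scal r x) ∸ e (scal q x) :=
      fun r q => by rw [diff_scal, he.map_diff]
    have hmono : ∀ r q : unitInterval, r ≤ q → (e (scal r x) : ℝ) ≤ e (scal q x) := by
      intro r q h
      have h2 := hd r q
      rw [le_iff_diff.1 ((unitInterval.mvLe_iff r q).2 h), ← diff_self (0 : unitInterval), hd,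
        diff_self, eq_comm, ← le_iff_diff, unitInterval.mvLe_iff] at h2
      exact h2
    have hsub : ∀ r q : unitInterval, q ≤ r →
        (e (scal (r ∸ q) x) : ℝ) = e (scal r x) - e (scal q x) := by
      intro r q h
      rw [hd, unitInterval.coe_diff, max_eq_left (sub_nonneg.2 (hmono q r h))]
    -- Projecting onto `[0,1]` extends `r ↦ e (scal r x)` to the real line.
    let p : ℝ → unitInterval := Set.projIcc 0 1 zero_le_one
    have hp : ∀ a (h0 : 0 ≤ a) (h1 : a ≤ 1), p a = ⟨a, h0, h1⟩ :=
      fun a h0 h1 => Set.projIcc_of_mem zero_le_one ⟨h0, h1⟩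
    have key := eq_mul_of_additive_of_bounded (g := fun a => (e (scal (p a) x) : ℝ)) (C := 1)
      (by
        intro a b ha hb hab
        have h := hsub (p (a + b)) (p b) (by
          rw [hp b hb (by linarith), hp _ (by linarith) hab]
          exact Subtype.mk_le_mk.2 (by linarith))
        have e1 : p (a + b) ∸ p b = p a := by
          rw [hp b hb (by linarith), hp _ (by linarith) hab, hp a ha (by linarith)]
          apply Subtype.ext
          rw [unitInterval.coe_diff]
          simp [ha]
        rw [e1] at h
        change (e (scal (p (a + b)) x) : ℝ) = e (scal (p a) x) + e (scal (p b) x)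
        linarith)
      (by
        intro a _ _
        rw [abs_of_nonneg (e (scal (p a) x)).2.1]
        exact (e (scal (p a) x)).2.2) r.2.1 r.2.2
    apply Subtype.ext
    rw [unitInterval.coe_scal]
    have h1 : p 1 = 1 := hp 1 zero_le_one le_rfl
    have hr : p r = r := hp r r.2.1 r.2.2
    simpa only [h1, hr, one_scal] using key

/-- The condition `x ⊙ y = 0` says `x ≤ y*`, so `e x + e y ≤ 1` and the truncated sum is the real
sum. -/
theorem isState (he : IsMVHom e) : IsState e where
  additive x y h := by
    rw [odot_eq_diff, ← le_iff_diff] at h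
    rw [he.map_oplus, unitInterval.coe_oplus, min_eq_left]
    have h2 := congrArg (fun t => ((e t : unitInterval) : ℝ)) (le_iff_diff.1 h)
    simp only [he.map_diff, he.map_zero, he.map_neg, unitInterval.coe_diff,
      unitInterval.coe_mvNeg, unitInterval.mvZero_eq, Set.Icc.coe_zero] at h2
    linarith [le_max_left ((e x : ℝ) - (1 - e y)) 0]
  normalized := by rw [he.map_one, unitInterval.mvOne_eq]
  homogeneous r x := by rw [he.isRieszMVHom.map_scal, unitInterval.coe_scal]

end IsMVHom

/-! ### Elementary properties of states. -/

namespace IsState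

variable {R : Type*} [RieszMVAlgebra R] {s : R → unitInterval}

/-- The sum `(y ∸ x) ∔ x` is one to which additivity applies, as `(y ∸ x) ⊙ x = 0`. -/
theorem map_diff_add (hs : IsState s) {x y : R} (h : x ≼ y) :
    (s (y ∸ x) : ℝ) + s x = s y := by
  have hz : odot (y ∸ x) x = zero := by
    rw [← odot_neg_eq_diff, odot_assoc, odot_comm (neg x), odot_neg_self, odot_zero]
  rw [← hs.additive _ _ hz, h.diff_oplus]

theorem mono (hs : IsState s) {x y : R} (h : x ≼ y) : (s x : ℝ) ≤ s y := by
  rw [← hs.map_diff_add h]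
  exact le_add_of_nonneg_left (s (y ∸ x)).2.1

theorem map_zero (hs : IsState s) : (s zero : ℝ) = 0 := by
  have h := hs.map_diff_add (Le.refl (zero : R))
  rw [diff_self] at h
  linarith

theorem map_one (hs : IsState s) : (s one : ℝ) = 1 := by rw [hs.normalized, Set.Icc.coe_one]

theorem map_neg (hs : IsState s) (x : R) : (s (neg x) : ℝ) = 1 - s x := by
  have h := hs.map_diff_add (le_one x)
  rw [one_diff, hs.map_one] at h
  linarith

theorem map_const (hs : IsState s) (r : unitInterval) : (s (const r) : ℝ) = r := by
  rw [const, hs.homogeneous, hs.map_one, mul_one]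

theorem map_oplus_le (hs : IsState s) (x y : R) : (s (x ∔ y) : ℝ) ≤ s x + s y := by
  rw [← hs.map_diff_add (le_oplus_left x y)]
  have h : (x ∔ y) ∸ y ≼ x := diff_le_iff.2 (by rw [oplus_comm]; exact Le.refl _)
  linarith [hs.mono h]

theorem map_nmul_le (hs : IsState s) (n : ℕ) (x : R) : (s (nmul n x) : ℝ) ≤ n * s x := by
  induction n with
  | zero => simp [nmul, hs.map_zero]
  | succ n ih =>
    rw [nmul]
    push_cast
    linarith [hs.map_oplus_le (nmul n x) x]

end IsState

/-! ### Linear combinations inside the algebra, and coherence of states. -/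

namespace RieszMVAlgebra

variable {R : Type*} [RieszMVAlgebra R]

/-- Sums with nonnegative weights of total at most `1` exist in a Riesz MV-algebra. -/
theorem exists_weighted_sum {ι : Type*} (S : Finset ι) (w : ι → unitInterval) (y : ι → R)
    (hw : ∑ i ∈ S, (w i : ℝ) ≤ 1) :
    ∃ P : R, (∀ q : unitInterval, (q : ℝ) = ∑ i ∈ S, (w i : ℝ) → P ≼ const q) ∧
      ∀ s : R → unitInterval, IsState s → (s P : ℝ) = ∑ i ∈ S, (w i : ℝ) * s (y i) := by
  classical
  induction S using Finset.induction_on with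
  | empty => exact ⟨zero, fun q _ => zero_le _, fun s hs => by simp [hs.map_zero]⟩
  | insert a S ha ih =>
    rw [Finset.sum_insert ha] at hw
    have hS : 0 ≤ ∑ i ∈ S, (w i : ℝ) := Finset.sum_nonneg fun i _ => (w i).2.1
    have hwa := (w a).2.1
    obtain ⟨P, hP, hPs⟩ := ih (by linarith)
    let q : unitInterval := ⟨∑ i ∈ S, (w i : ℝ), hS, by linarith⟩
    have hPq : P ≼ const q := hP q rfl
    have hy : scal (w a) (y a) ≼ const (w a) := scal_mono _ (le_one _)
    -- The bound of `P` by the constant of its total weight is carried through the induction to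
    -- ensure that the next summand satisfies the hypothesis of additivity.
    refine ⟨scal (w a) (y a) ∔ P, fun t ht => ?_, fun s hs => ?_⟩
    · have e : t = w a ∔ q := by
        apply Subtype.ext
        rw [ht, unitInterval.coe_oplus, Finset.sum_insert ha, min_eq_left hw]
      rw [e, isMVHom_const.map_oplus]
      exact hy.oplus hPq
    · rw [Finset.sum_insert ha, ← hPs s hs, ← hs.homogeneous, hs.additive]
      rw [odot_eq_diff, ← le_iff_diff]
      refine hy.trans (Le.trans ?_ (neg_le_neg_iff.2 hPq))
      rw [← isMVHom_const.map_neg, le_iff_diff, ← isMVHom_const.map_diff,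
        le_iff_diff.1 ((unitInterval.mvLe_iff _ _).2 _), isMVHom_const.map_zero]
      rw [← Subtype.coe_le_coe, unitInterval.coe_mvNeg]
      change (w a : ℝ) ≤ 1 - ∑ i ∈ S, (w i : ℝ)
      linarith

/-- Up to a shift and a positive factor, every real linear combination is realised in a Riesz
MV-algebra, uniformly for all states. -/
theorem exists_linear_combination {ι : Type*} [Fintype ι] (c : ι → ℝ) (x : ι → R) :
    ∃ N : ℕ, 0 < N ∧ ∑ i, |c i| ≤ N ∧ ∃ P : R, ∀ s : R → unitInterval, IsState s →
      (N : ℝ) * s P = ∑ i, (c i * s (x i) + max (-c i) 0) := by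
  classical
  obtain ⟨N, hN⟩ := exists_nat_gt (∑ i, |c i|)
  have h0 : 0 ≤ ∑ i, |c i| := Finset.sum_nonneg fun i _ => abs_nonneg _
  have hN0 : (0 : ℝ) < N := h0.trans_lt hN
  have hci : ∀ i, |c i| ≤ N := fun i =>
    (Finset.single_le_sum (f := fun i => |c i|) (fun i _ => abs_nonneg _)
      (Finset.mem_univ i)).trans hN.le
  -- Negative coefficients are moved to complements: for `c < 0`, `|c| * s (neg x) = c * s x - c`,
  -- which accounts for the shift `max (-c) 0`.
  obtain ⟨P, -, hP⟩ := exists_weighted_sum Finset.univ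
    (fun i => (⟨|c i| / N, by positivity, (div_le_one hN0).2 (hci i)⟩ : unitInterval))
    (fun i => if 0 ≤ c i then x i else neg (x i)) (by
      rw [← Finset.sum_div]
      exact (div_le_one hN0).2 hN.le)
  refine ⟨N, Nat.cast_pos.1 hN0, hN.le, P, fun s hs => ?_⟩
  rw [hP s hs, Finset.mul_sum]
  refine Finset.sum_congr rfl fun i _ => ?_
  rw [← mul_assoc, mul_div_cancel₀ _ hN0.ne']
  by_cases h : 0 ≤ c i
  · rw [if_pos h, abs_of_nonneg h, max_eq_right (by linarith), add_zero]
  · have h' : c i < 0 := not_le.1 h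
    rw [if_neg h, abs_of_neg h', max_eq_left (by linarith), hs.map_neg]
    ring

end RieszMVAlgebra

/-- Some morphism to `[0,1]` takes a value at `P` that is at most that of a given state. -/
theorem IsState.exists_isMVHom_le {R : Type*} [RieszMVAlgebra R] {s : R → unitInterval}
    (hs : IsState s) (P : R) : ∃ e : R → unitInterval, IsMVHom e ∧ e P ≤ s P := by
  obtain ⟨e, he, h⟩ := exists_isMVHom_eq_zero (a := P ∸ const (s P)) (by
    intro n hn
    -- If a multiple of `P ∸ const (s P)` were `1`, disjointness would give `const (s P) ≼ P`. The
    -- state would then vanish on the difference, hence on its multiples, and so on `1`.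
    have hd : Disj (nmul n (P ∸ const (s P))) (const (s P) ∸ P) := (disj_diff_diff _ _).nmul n
    rw [hn] at hd
    have hle : const (s P) ≼ P := le_iff_diff.2 (hd _ (le_one _) (Le.refl _))
    have h1 := hs.map_diff_add hle
    rw [hs.map_const] at h1
    have h2 := hs.map_nmul_le n (P ∸ const (s P))
    have h3 : (s (P ∸ const (s P)) : ℝ) = 0 := by linarith
    rw [hn, hs.map_one, h3] at h2
    linarith)
  refine ⟨e, he, ?_⟩
  rw [he.map_diff] at h
  have h2 := congrArg (fun t : unitInterval => (t : ℝ)) h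
  simp only [unitInterval.coe_diff, Set.Icc.coe_zero, he.isState.map_const] at h2
  rw [← Subtype.coe_le_coe]
  linarith [le_max_left ((e P : ℝ) - s P) 0]

/-- The values of a state satisfy de Finetti's coherence condition. -/
theorem IsState.coherent {R : Type*} [RieszMVAlgebra R] {s : R → unitInterval} (hs : IsState s)
    {ι : Type*} [Fintype ι] (x : ι → R) (c : ι → ℝ) :
    ∃ e : R → unitInterval, IsMVHom e ∧ 0 ≤ ∑ i, c i * ((s (x i) : ℝ) - e (x i)) := by
  obtain ⟨N, hN, -, P, hP⟩ := exists_linear_combination c x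
  obtain ⟨e, he, hle⟩ := hs.exists_isMVHom_le P
  refine ⟨e, he, ?_⟩
  have h1 := hP s hs
  have h2 := hP e he.isState
  have h3 : (N : ℝ) * e P ≤ N * s P := mul_le_mul_of_nonneg_left hle (Nat.cast_nonneg N)
  rw [h1, h2, Finset.sum_add_distrib, Finset.sum_add_distrib] at h3
  simp only [mul_sub, Finset.sum_sub_distrib]
  linarith

/-! ### Convex hulls and compactness. -/

/-- Carathéodory's theorem with exactly `d + 1` points, repetitions allowed. -/
theorem exists_fin_of_mem_convexHull {E : Type*} [AddCommGroup E] [Module ℝ E]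
    [FiniteDimensional ℝ E] {S : Set E} {p : E} {d : ℕ} (hd : Module.finrank ℝ E = d)
    (hp : p ∈ convexHull ℝ S) :
    ∃ (α : Fin (d + 1) → ℝ) (z : Fin (d + 1) → E),
      α ∈ stdSimplex ℝ (Fin (d + 1)) ∧ (∀ j, z j ∈ S) ∧ ∑ j, α j • z j = p := by
  obtain ⟨ι, _, z, w, hz, hind, hw, hw1, hsum⟩ := eq_pos_convex_span_of_mem_convexHull hp
  have hcard : Fintype.card ι ≤ Fintype.card (Fin (d + 1)) := by
    rw [Fintype.card_fin, ← hd]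
    exact hind.card_le_finrank_succ.trans (Nat.succ_le_succ (Submodule.finrank_le _))
  obtain ⟨f⟩ := Function.Embedding.nonempty_of_card_le hcard
  obtain ⟨z₀, hz₀⟩ : S.Nonempty := (convexHull_nonempty_iff (𝕜 := ℝ)).1 ⟨p, hp⟩
  -- Unused indices receive weight zero and the arbitrary point `z₀` of `S`.
  refine ⟨Function.extend f w 0, Function.extend f z fun _ => z₀, ⟨fun j => ?_, ?_⟩, fun j => ?_, ?_⟩
  · by_cases h : ∃ i, f i = j
    · obtain ⟨i, rfl⟩ := h
      rw [f.injective.extend_apply]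
      exact (hw i).le
    · rw [Function.extend_apply' _ _ _ h]
      exact le_rfl
  · rw [← hw1]
    refine (Fintype.sum_of_injective f f.injective _ _ (fun j h => ?_) fun i => ?_).symm
    · rw [Function.extend_apply' _ _ _ h]
      rfl
    · rw [f.injective.extend_apply]
  · by_cases h : ∃ i, f i = j
    · obtain ⟨i, rfl⟩ := h
      rw [f.injective.extend_apply]
      exact hz ⟨i, rfl⟩
    · rwa [Function.extend_apply' _ _ _ h]
  · rw [← hsum]
    refine (Fintype.sum_of_injective f f.injective _ _ (fun j h => ?_) fun i => ?_).symm
    · rw [Function.extend_apply' _ _ _ h]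
      exact zero_smul _ _
    · rw [f.injective.extend_apply, f.injective.extend_apply]

/-- The convex hull of a compact set in a finite-dimensional space is compact. -/
theorem IsCompact.isCompact_convexHull_of_finiteDimensional {E : Type*} [NormedAddCommGroup E]
    [NormedSpace ℝ E] [FiniteDimensional ℝ E] {S : Set E} (hS : IsCompact S) :
    IsCompact (convexHull ℝ S) := by
  -- With a fixed number of points, the hull is the continuous image of a simplex times a power of
  -- `S`.
  let F : (Fin (Module.finrank ℝ E + 1) → ℝ) × (Fin (Module.finrank ℝ E + 1) → E) → E :=
    fun q => ∑ j, q.1 j • q.2 j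
  have hF : Continuous F := by fun_prop
  have hK := ((isCompact_stdSimplex ℝ (Fin (Module.finrank ℝ E + 1))).prod
    (isCompact_univ_pi fun _ : Fin (Module.finrank ℝ E + 1) => hS)).image hF
  convert hK using 1
  apply Set.Subset.antisymm
  · intro p hp
    obtain ⟨α, z, hα, hz, h⟩ := exists_fin_of_mem_convexHull rfl hp
    exact ⟨(α, z), ⟨hα, fun j _ => hz j⟩, h⟩
  · rintro _ ⟨⟨α, z⟩, ⟨hα, hz⟩, rfl⟩
    exact (convex_convexHull ℝ S).sum_mem (fun j _ => hα.1 j) hα.2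
      fun j _ => subset_convexHull ℝ S (hz j trivial)

theorem unitInterval.continuous_mvNeg :
    Continuous (MVAlgebra.neg : unitInterval → unitInterval) :=
  Continuous.subtype_mk (continuous_const.sub continuous_subtype_val) _

theorem unitInterval.continuous_oplus :
    Continuous fun p : unitInterval × unitInterval => p.1 ∔ p.2 :=
  Continuous.subtype_mk (((continuous_subtype_val.comp continuous_fst).add
    (continuous_subtype_val.comp continuous_snd)).min continuous_const) _

/-- The morphisms to `[0,1]` form a compact space for pointwise convergence. -/
theorem isCompact_setOf_isMVHom (A : Type*) [MVAlgebra A] :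
    IsCompact {e : A → unitInterval | IsMVHom e} := by
  apply IsClosed.isCompact
  have h : {e : A → unitInterval | IsMVHom e} =
      {e | e zero = zero} ∩ (⋂ x, ⋂ y, {e | e (x ∔ y) = e x ∔ e y}) ∩
        ⋂ x, {e | e (neg x) = neg (e x)} := by
    ext e
    simp only [Set.mem_inter_iff, Set.mem_iInter, Set.mem_ofPred_eq]
    exact ⟨fun h => ⟨⟨h.1, h.2⟩, h.3⟩, fun h => ⟨h.1.1, h.1.2, h.2⟩⟩
  rw [h]
  refine ((isClosed_eq (continuous_apply _) continuous_const).inter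
    (isClosed_iInter fun x => isClosed_iInter fun y => isClosed_eq (continuous_apply _) ?_)).inter
    (isClosed_iInter fun x => isClosed_eq (continuous_apply _) ?_)
  · exact unitInterval.continuous_oplus.comp (f := fun e : A → unitInterval => (e x, e y))
      ((continuous_apply x).prodMk (continuous_apply y))
  · exact unitInterval.continuous_mvNeg.comp (continuous_apply x)

/-- Coherent values are convex combinations of the values of morphisms. -/
theorem exists_convex_combination_of_coherent {A : Type*} [MVAlgebra A] {k : ℕ} (x : Fin k → A)
    (r : Fin k → ℝ)
    (h : ∀ c : Fin k → ℝ, ∃ e : A → unitInterval, IsMVHom e ∧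
      0 ≤ ∑ i, c i * (r i - (e (x i) : ℝ))) :
    ∃ (e : Fin (k + 1) → A → unitInterval) (α : Fin (k + 1) → ℝ),
      (∀ j, IsMVHom (e j)) ∧ (∀ j, 0 ≤ α j) ∧ ∑ j, α j = 1 ∧
        ∀ i, r i = ∑ j, α j * (e j (x i) : ℝ) := by
  let ev : (A → unitInterval) → Fin k → ℝ := fun e i => e (x i)
  have hev : Continuous ev := continuous_pi fun i =>
    continuous_subtype_val.comp (continuous_apply (x i))
  have hcomp : IsCompact (ev '' {e | IsMVHom e}) := (isCompact_setOf_isMVHom A).image hev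
  have hmem : r ∈ convexHull ℝ (ev '' {e | IsMVHom e}) := by
    by_contra hr
    obtain ⟨f, u, hfu, hf⟩ := geometric_hahn_banach_point_closed (convex_convexHull ℝ _)
      hcomp.isCompact_convexHull_of_finiteDimensional.isClosed hr
    -- The coefficients of the separating functional serve as stakes: coherence gives `f r ≥ f (ev
    -- e)` for some `e`, whereas separation gives `f r < u < f (ev e)`.
    obtain ⟨e, he, h0⟩ := h fun i => f (Pi.single i 1)
    have hfe := hf (ev e) (subset_convexHull ℝ _ ⟨e, he, rfl⟩)
    have hsum : ∑ i, f (Pi.single i 1) * (r i - (e (x i) : ℝ)) = f (r - ev e) := by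
      conv_rhs => rw [pi_eq_sum_univ' (r - ev e), map_sum]
      refine Finset.sum_congr rfl fun i _ => ?_
      rw [map_smul, smul_eq_mul, mul_comm]
      rfl
    rw [hsum, map_sub] at h0
    linarith
  obtain ⟨α, z, hα, hz, hsum⟩ :=
    exists_fin_of_mem_convexHull (Module.finrank_fin_fun ℝ) hmem
  choose e he hez using hz
  refine ⟨e, α, he, hα.1, hα.2, fun i => ?_⟩
  rw [← hsum, Finset.sum_apply]
  refine Finset.sum_congr rfl fun j _ => ?_
  rw [Pi.smul_apply, smul_eq_mul, ← hez j]

/-- A convex combination of morphisms is a state. -/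
theorem exists_isState_of_convex_combination {R : Type*} [RieszMVAlgebra R] {ι : Type*}
    [Fintype ι] {e : ι → R → unitInterval} {α : ι → ℝ} (he : ∀ j, IsMVHom (e j))
    (hα : ∀ j, 0 ≤ α j) (hα1 : ∑ j, α j = 1) :
    ∃ s : R → unitInterval, IsState s ∧ ∀ y, (s y : ℝ) = ∑ j, α j * (e j y : ℝ) := by
  refine ⟨fun y => ⟨∑ j, α j * (e j y : ℝ),
    Finset.sum_nonneg fun j _ => mul_nonneg (hα j) (e j y).2.1, ?_⟩, ⟨?_, ?_, ?_⟩, fun y => rfl⟩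
  · rw [← hα1]
    exact Finset.sum_le_sum fun j _ => mul_le_of_le_one_right (hα j) (e j y).2.2
  · intro y z h
    simp only [(he _).isState.additive y z h, mul_add, Finset.sum_add_distrib]
  · apply Subtype.ext
    simp only [(he _).isState.map_one, mul_one, hα1, Set.Icc.coe_one]
  · intro r y
    simp only [(he _).isState.homogeneous, Finset.mul_sum]
    exact Finset.sum_congr rfl fun j _ => by ring

/-! ### De Finetti's theorem for Riesz MV-algebras. -/

/-- De Finetti's theorem for Riesz MV-algebras. -/
theorem tfae_coherent_state_convex_combination {R : Type*} [RieszMVAlgebra R] {k : ℕ}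
    (x : Fin k → R) (r : Fin k → unitInterval) :
    List.TFAE
      [∀ c : Fin k → ℝ, ∃ e : R → unitInterval, IsMVHom e ∧
          0 ≤ ∑ i, c i * ((r i : ℝ) - (e (x i) : ℝ)),
        ∃ s : R → unitInterval, IsState s ∧ ∀ i, s (x i) = r i,
        ∃ m : ℕ, m ≤ k + 1 ∧ ∃ (e : Fin m → R → unitInterval) (α : Fin m → ℝ),
          (∀ j, IsRieszMVHom (e j)) ∧ (∀ j, 0 ≤ α j) ∧ ∑ j, α j = 1 ∧
          ∀ i, (r i : ℝ) = ∑ j, α j * (e j (x i) : ℝ)] := by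
  tfae_have 1 → 3 := by
    intro h
    obtain ⟨e, α, he, hα, hα1, hr⟩ := exists_convex_combination_of_coherent x (fun i => (r i : ℝ)) h
    exact ⟨k + 1, le_rfl, e, α, fun j => (he j).isRieszMVHom, hα, hα1, hr⟩
  tfae_have 3 → 2 := by
    rintro ⟨m, -, e, α, he, hα, hα1, hr⟩
    obtain ⟨s, hs, h⟩ :=
      exists_isState_of_convex_combination (fun j => (he j).toIsMVHom) hα hα1
    exact ⟨s, hs, fun i => Subtype.ext ((h (x i)).trans (hr i).symm)⟩
  tfae_have 2 → 1 := by
    rintro ⟨s, hs, h⟩ c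
    simp only [← h]
    exact hs.coherent x c
  tfae_finish

/-! ### Soundness, and evaluations as morphisms of the Lindenbaum-Tarski algebra. -/

namespace Formula

/-- Soundness of `ℝℒ` for Riesz MV-algebras. -/
theorem Provable.eval_eq_one {V R : Type*} [RieszMVAlgebra R] {φ : Formula V} (h : Provable φ)
    (v : V → R) : eval v φ = one := by
  have hiff : ∀ φ ψ : Formula V, eval v φ = eval v ψ → eval v (iff φ ψ) = one := by
    intro φ ψ h
    simp only [iff, and, or, eval, h, neg_oplus_self, MVAlgebra.neg_one,
      oplus_zero, MVAlgebra.neg_zero]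
  have hneg : ∀ a b : R, a ∔ MVAlgebra.neg b = MVAlgebra.neg (b ∸ a) :=
    fun a b => by rw [neg_diff, oplus_comm]
  induction h with
  | luk1 φ ψ =>
    change eval v φ ≼ MVAlgebra.neg (eval v ψ) ∔ eval v φ
    exact le_oplus_left _ _
  | luk2 φ ψ χ =>
    change MVAlgebra.neg (eval v φ) ∔ eval v ψ ≼
      MVAlgebra.neg (MVAlgebra.neg (eval v ψ) ∔ eval v χ) ∔ (MVAlgebra.neg (eval v φ) ∔ eval v χ)
    have e : MVAlgebra.neg (MVAlgebra.neg (eval v ψ) ∔ eval v χ) ∔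
        (MVAlgebra.neg (eval v φ) ∔ eval v χ) =
        MVAlgebra.neg (eval v φ) ∔ ((eval v ψ ∸ eval v χ) ∔ eval v χ) := by rw [diff]; ac_rfl
    rw [e]
    exact (Le.refl _).oplus (le_diff_oplus _ _)
  | luk3 φ ψ =>
    change (eval v φ ∸ eval v ψ) ∔ eval v ψ ≼ (eval v ψ ∸ eval v φ) ∔ eval v φ
    rw [diff_oplus_comm]
    exact Le.refl _
  | luk4 φ ψ =>
    change MVAlgebra.neg (MVAlgebra.neg (eval v φ)) ∔ MVAlgebra.neg (eval v ψ) ≼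
      MVAlgebra.neg (eval v ψ) ∔ eval v φ
    rw [MVAlgebra.neg_neg, oplus_comm]
    exact Le.refl _
  | rl1 r φ ψ =>
    apply hiff
    simp only [eval, MVAlgebra.neg_neg]
    rw [hneg, ← scal_diff, diff, MVAlgebra.neg_neg, oplus_comm]
  | rl2 r q φ =>
    apply hiff
    simp only [eval, MVAlgebra.neg_neg]
    rw [hneg, odot_neg_scal, odot_neg_eq_diff]
  | rl3 r q φ =>
    apply hiff
    simp only [eval, MVAlgebra.neg_neg, scal_scal]
  | rl4 φ =>
    apply hiff
    simp only [eval, one_scal, MVAlgebra.neg_neg]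
  | mp _ _ ih ih' => rwa [eval, ih, MVAlgebra.neg_one, zero_oplus] at ih'

end Formula

namespace Lindenbaum

open Formula

variable {V R : Type*} [RieszMVAlgebra R]

/-- The map induced by an evaluation on the Lindenbaum-Tarski algebra. -/
def evalHom (v : V → R) : Lindenbaum V → R :=
  Quotient.lift (s := Formula.setoid V) (eval v)
    fun _ _ h => Le.antisymm (h.1.eval_eq_one v) (h.2.eval_eq_one v)

theorem evalHom_mk (v : V → R) (φ : Formula V) : evalHom v (mk φ) = eval v φ := rfl

theorem isMVHom_evalHom [Inhabited V] (v : V → R) : IsMVHom (evalHom v) where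
  map_zero := by
    change MVAlgebra.neg (MVAlgebra.neg (v default) ∔ v default) = MVAlgebra.zero
    rw [neg_oplus_self, MVAlgebra.neg_one]
  map_oplus := by
    rintro ⟨φ⟩ ⟨ψ⟩
    change MVAlgebra.neg (MVAlgebra.neg (eval v φ)) ∔ eval v ψ = eval v φ ∔ eval v ψ
    rw [MVAlgebra.neg_neg]
  map_neg := by
    rintro ⟨φ⟩
    rfl

theorem isEvaluation_of_isRieszMVHom [Inhabited V] {h : Lindenbaum V → R} (hh : IsRieszMVHom h) :
    IsEvaluation fun φ => h (mk φ) where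
  map_imp φ ψ := by
    rw [← hh.map_neg, ← hh.map_oplus]
    exact congrArg h (mk_imp (mk_neg_neg φ).symm rfl)
  map_neg φ := hh.map_neg (mk φ)
  map_nabla r φ := by
    rw [← hh.map_neg, ← hh.map_scal, ← hh.map_neg]
    exact congrArg h ((mk_neg_neg _).trans (mk_nabla r (mk_neg_neg φ))).symm

end Lindenbaum

/-! ### Coherent books and quasi-linear combinations. -/

namespace Formula

/-- Evaluations factor through the quotient by soundness. Conversely, an MV-morphism composed with
`mk` is an evaluation, since it preserves scalars automatically. -/
theorem isCoherentBook_iff {V : Type*} [Inhabited V] {k : ℕ} (φ : Fin k → Formula V)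
    (r : Fin k → unitInterval) :
    IsCoherentBook φ r ↔ ∀ c : Fin k → ℝ, ∃ e : Lindenbaum V → unitInterval, IsMVHom e ∧
      0 ≤ ∑ i, c i * ((r i : ℝ) - (e (Lindenbaum.mk (φ i)) : ℝ)) := by
  refine forall_congr' fun c => ⟨?_, ?_⟩
  · rintro ⟨e, he, h⟩
    refine ⟨_, Lindenbaum.isMVHom_evalHom fun i => e (var i), ?_⟩
    simpa only [Lindenbaum.evalHom_mk, ← he.eq_eval] using h
  · rintro ⟨e, he, h⟩
    exact ⟨_, Lindenbaum.isEvaluation_of_isRieszMVHom he.isRieszMVHom, h⟩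

/-- Truncated linear combinations of shifted term functions are term functions. -/
theorem exists_termFun_eq_trunc {n : ℕ} [NeZero n] {k : ℕ} (φ : Fin k → Formula (Fin n))
    (r : Fin k → unitInterval) (c : Fin k → ℝ) :
    ∃ ψ : Formula (Fin n), ∀ v,
      (termFun ψ v : ℝ) = trunc (∑ i, c i * (((φ i).termFun v : ℝ) - (r i : ℝ))) := by
  obtain ⟨N, hN, hcN, P, hP⟩ := exists_linear_combination c fun i => Lindenbaum.mk (φ i)
  have hN0 : (0 : ℝ) < N := Nat.cast_pos.2 hN
  have hterm : ∀ i, 0 ≤ c i * (r i : ℝ) + max (-c i) 0 ∧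
      c i * (r i : ℝ) + max (-c i) 0 ≤ |c i| := by
    intro i
    have h0 := (r i).2.1
    have h1 := (r i).2.2
    rcases le_total 0 (c i) with h | h
    · rw [max_eq_right (by linarith), abs_of_nonneg h]
      constructor <;> nlinarith
    · rw [max_eq_left (by linarith), abs_of_nonpos h]
      constructor <;> nlinarith
  -- `N * d` is the shifted combination evaluated at `r`. Subtracting `d` from `P` cancels the shift
  -- and truncates at `0`; the `N`-fold sum restores the scale and truncates at `1`.
  let d : unitInterval := ⟨(∑ i, (c i * (r i : ℝ) + max (-c i) 0)) / N,
    div_nonneg (Finset.sum_nonneg fun i _ => (hterm i).1) hN0.le,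
    (div_le_one hN0).2 ((Finset.sum_le_sum fun i _ => (hterm i).2).trans hcN)⟩
  have hd : (N : ℝ) * d = ∑ i, (c i * (r i : ℝ) + max (-c i) 0) := mul_div_cancel₀ _ hN0.ne'
  obtain ⟨ψ, hψ⟩ : ∃ ψ, Lindenbaum.mk ψ = nmul N (P ∸ const d) := Quotient.exists_rep _
  refine ⟨ψ, fun v => ?_⟩
  have hv := Lindenbaum.isMVHom_evalHom v
  have e : termFun ψ v = nmul N (Lindenbaum.evalHom v P ∸ Lindenbaum.evalHom v (const d)) := by
    rw [← hv.map_diff, ← hv.map_nmul, ← hψ]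
    rfl
  rw [e, unitInterval.coe_nmul, unitInterval.coe_diff, hv.isState.map_const,
    mul_max_of_nonneg _ _ hN0.le, mul_sub, mul_zero, hd, hP _ hv.isState,
    Finset.sum_add_distrib, Finset.sum_add_distrib, add_sub_add_right_eq_sub,
    ← Finset.sum_sub_distrib, trunc]
  simp only [mul_sub]
  rfl

/-- As `trunc t = 0` exactly when `t ≤ 0`, an evaluation sends the formula with coefficients `c` to
`0` exactly when it satisfies the coherence inequality for `c`. -/
theorem isCoherentBook_iff_quasiLinearSpan {n : ℕ} [NeZero n] {k : ℕ}
    (φ : Fin k → Formula (Fin n)) (r : Fin k → unitInterval) :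
    IsCoherentBook φ r ↔
      ∀ ψ ∈ quasiLinearSpan (fun i x => ((φ i).termFun x : ℝ) - (r i : ℝ)), ψ.Invalid := by
  constructor
  · rintro h ψ ⟨c, hc⟩
    obtain ⟨e, he, h0⟩ := h c
    refine ⟨e, he, Subtype.ext ?_⟩
    have h1 := hc fun i => e (var i)
    simp only [termFun, ← he.eq_eval] at h1
    have h2 : ∑ i, c i * ((e (φ i) : ℝ) - (r i : ℝ)) ≤ 0 := by
      rw [← neg_nonneg, ← Finset.sum_neg_distrib]
      simpa only [← mul_neg, neg_sub] using h0
    rw [h1, trunc, max_eq_right h2]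
    exact min_eq_left zero_le_one
  · intro h c
    obtain ⟨ψ, hψ⟩ := exists_termFun_eq_trunc φ r c
    obtain ⟨e, he, h0⟩ := h ψ ⟨c, hψ⟩
    refine ⟨e, he, ?_⟩
    have h1 := hψ fun i => e (var i)
    simp only [termFun, ← he.eq_eval, h0, trunc, Set.Icc.coe_zero] at h1
    have h2 : ∑ i, c i * ((e (φ i) : ℝ) - (r i : ℝ)) ≤ 0 := by
      by_contra! hpos
      rw [max_eq_left hpos.le] at h1
      exact absurd h1 (lt_min hpos one_pos).ne
    rw [← neg_nonneg, ← Finset.sum_neg_distrib] at h2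
    simpa only [← mul_neg, neg_sub] using h2

end Formula

theorem theorem8p13 :
    (∀ (n : ℕ) [NeZero n] (k : ℕ) (φ : Fin k → Formula (Fin n)) (r : Fin k → unitInterval),
      List.TFAE
        [Formula.IsCoherentBook φ r,
          ∃ s : Lindenbaum (Fin n) → unitInterval,
            IsState s ∧ ∀ i, s (Lindenbaum.mk (φ i)) = r i,
          ∀ ψ ∈ Formula.quasiLinearSpan
              (fun i x => ((φ i).termFun x : ℝ) - (r i : ℝ)),
            ψ.Invalid]) ∧
    (∀ (R : Type*) [RieszMVAlgebra R] (k : ℕ) (x : Fin k → R) (β : Set.range x → unitInterval),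
      List.TFAE
        [IsCoherentMap x β,
          ∃ s : R → unitInterval,
            IsState s ∧ ∀ i, s (x i) = β ⟨x i, Set.mem_range_self i⟩,
          ∃ m : ℕ, m ≤ k + 1 ∧ ∃ (e : Fin m → R → unitInterval) (α : Fin m → ℝ),
            (∀ j, IsRieszMVHom (e j)) ∧ (∀ j, 0 ≤ α j) ∧ ∑ j, α j = 1 ∧
            ∀ i, (β ⟨x i, Set.mem_range_self i⟩ : ℝ) = ∑ j, α j * (e j (x i) : ℝ)]) := by

  refine ⟨fun n _ k φ r => ?_, fun R _ k x β => ?_⟩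
  · tfae_have 1 ↔ 2 := (Formula.isCoherentBook_iff φ r).trans
      ((tfae_coherent_state_convex_combination (fun i => Lindenbaum.mk (φ i)) r).out 0 1)
    tfae_have 1 ↔ 3 := Formula.isCoherentBook_iff_quasiLinearSpan φ r
    tfae_finish
  · exact tfae_coherent_state_convex_combination x fun i => β ⟨x i, Set.mem_range_self i⟩
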